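/- Let $M$ be a closed (compact, without boundary) smooth $3$-manifold. A contact metric structure $(\eta,\xi,\phi,g)$ on $M$ consists of a contact form $\eta$ ($\eta\wedge d\eta$ nowhere zero), a smooth vector field $\xi$, a smooth endomorphism field $\phi$ of $TM$ and a smooth Riemannian metric $g$ with $\eta(\xi)=g(\xi,\xi)=1$, $\phi^2=-\mathrm{Id}+\eta\otimes\xi$, $\phi\xi=0$ and $d\eta(X,Y)=2g(X,\phi Y)$, where $d\eta(X,Y)=X\eta(Y)-Y\eta(X)-\eta([X,Y])$. Put $h=\frac12\mathcal L_\xi\phi$, that is, $hX=\frac12([\xi,\phi X]-\phi[\xi,X])$. For smooth functions $\kappa,\mu$ on $M$, the structure is called a generalized Jacobi $(\kappa,\mu)$-structure if the curvature $R(X,Y)Z=\nabla_X\nabla_YZ-\nabla_Y\nabla_XZ-\nabla_{[X,Y]}Z$ of the Levi-Civita connection of $g$ satisfies $$R(X,\xi)\xi=\kappa\,(X-\eta(X)\xi)+\mu\,hX\qquad\text{for all vector fields }X.$$ Proposition. Let $(\eta,\xi,\phi,g)$ be a contact metric structure on $M$ with $g$ flat, let $E$ be a smooth unit vector field with $hE=E$,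 and let $f$ be a smooth real function on $M$ with $df(\xi)=0$ and $df(\phi E)=0$. Then: (1) there is a unique smooth Riemannian metric $g^f$ on $M$ with $$g^f(E,E)=1+f+\tfrac12f^2,\quad g^f(\phi E,\phi E)=1-f+\tfrac12f^2,\quad g^f(E,\phi E)=\tfrac12f^2,$$ $$g^f(\xi,E)=g^f(\xi,\phi E)=0,\quad g^f(\xi,\xi)=1;$$ (2) there is a unique endomorphism field $\phi^f$ of $TM$ with $d\eta(X,Y)=2g^f(X,\phi^fY)$ for all smooth vector fields $X,Y$; (3) $(\eta,\xi,\phi^f,g^f)$ is a contact metric structure on the closed manifold $M$, and it is a generalized Jacobi $(\kappa,\mu)$-structure (with $h$ replaced by $h^f=\frac12\mathcal L_\xi\phi^f$) for $$\kappa=\left(f-\tfrac12f^2\right)\left(2-f+\tfrac12f^2\right),\qquad \mu=2\left(f-\tfrac12f^2\right).$$ -/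

import Mathlib

open scoped Manifold ContDiff
open Bundle

namespace ContactThree

section Definitions

variable (M : Type*) [TopologicalSpace M] [ChartedSpace (EuclideanSpace ℝ (Fin 3)) M]

/-- (Not necessarily smooth) vector fields on a `3`-dimensional manifold. -/
abbrev VField : Type _ := Π x : M, TangentSpace (𝓡 3) x

/-- (Not necessarily smooth) one-forms. -/
abbrev OneForm : Type _ := Π x : M, TangentSpace (𝓡 3) x →L[ℝ] ℝ

/-- (Not necessarily smooth) fields of endomorphisms of the tangent bundle. -/
abbrev EndField : Type _ := Π x : M, TangentSpace (𝓡 3) x →L[ℝ] TangentSpace (𝓡 3) x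

variable [IsManifold (𝓡 3) ∞ M]

/-- Linear connections on the tangent bundle; `nabla Y x (X x)` is `(∇_X Y)(x)`. -/
abbrev Connection : Type _ :=
  CovariantDerivative (𝓡 3) (EuclideanSpace ℝ (Fin 3)) (TangentSpace (𝓡 3) : M → Type _)

/-- Smooth Riemannian metrics on a `3`-dimensional manifold. -/
abbrev Metric : Type _ :=
  ContMDiffRiemannianMetric (𝓡 3) ∞ (EuclideanSpace ℝ (Fin 3))
    (TangentSpace (𝓡 3) : M → Type _)

variable {M}

/-- Smoothness of a vector field. -/
def VField.IsSmooth (X : VField M) : Prop :=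
  ContMDiff (𝓡 3) (𝓡 3).tangent ∞ (fun x => (⟨x, X x⟩ : TangentBundle (𝓡 3) M))

/-- Smoothness of a one-form, as a section of the cotangent bundle. -/
def OneForm.IsSmooth (α : OneForm M) : Prop :=
  ContMDiff (𝓡 3) ((𝓡 3).prod 𝓘(ℝ, EuclideanSpace ℝ (Fin 3) →L[ℝ] ℝ)) ∞
    (fun x => TotalSpace.mk' (EuclideanSpace ℝ (Fin 3) →L[ℝ] ℝ)
      (E := fun x : M => TangentSpace (𝓡 3) x →L[ℝ] Bundle.Trivial M ℝ x) x (α x))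

/-- Smoothness of a field of endomorphisms, as a section of `End(TM)`. -/
def EndField.IsSmooth (A : EndField M) : Prop :=
  ContMDiff (𝓡 3)
    ((𝓡 3).prod 𝓘(ℝ, EuclideanSpace ℝ (Fin 3) →L[ℝ] EuclideanSpace ℝ (Fin 3))) ∞
    (fun x => TotalSpace.mk' (EuclideanSpace ℝ (Fin 3) →L[ℝ] EuclideanSpace ℝ (Fin 3))
      (E := fun x : M => TangentSpace (𝓡 3) x →L[ℝ] TangentSpace (𝓡 3) x) x (A x))

/-- The Lie bracket of vector fields. -/
noncomputable def bracket (X Y : VField M) : VField M :=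
  VectorField.mlieBracket (𝓡 3) X Y

/-- The exterior derivative of a one-form on (smooth) vector fields:
`dα(X, Y) = X(α(Y)) - Y(α(X)) - α([X, Y])`. -/
noncomputable def dForm (α : OneForm M) (X Y : VField M) (x : M) : ℝ :=
  mvfderiv (𝓡 3) (fun y => α y (Y y)) x (X x) - mvfderiv (𝓡 3) (fun y => α y (X y)) x (Y x)
    - α x (bracket X Y x)

/-- `α` is a contact form: a smooth one-form such that `α ∧ dα` is nowhere zero, i.e. it is
nonzero on triples of vector fields that are linearly independent at the given point. -/
def IsContactForm (α : OneForm M) : Prop :=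
  α.IsSmooth ∧
    ∀ X Y Z : VField M, X.IsSmooth → Y.IsSmooth → Z.IsSmooth → ∀ x : M,
      LinearIndependent ℝ ![X x, Y x, Z x] →
        α x (X x) * dForm α Y Z x + α x (Y x) * dForm α Z X x + α x (Z x) * dForm α X Y x ≠ 0

/-- The relation `dη = 2 g(·, φ ·)`. -/
def IsAssociated (η : OneForm M) (φ : EndField M) (g : Metric M) : Prop :=
  ∀ X Y : VField M, X.IsSmooth → Y.IsSmooth → ∀ x : M,
    dForm η X Y x = 2 * g.inner x (X x) (φ x (Y x))

/-- `(M, η, ξ, φ, g)` is a contact metric structure. -/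
structure IsContactMetric (η : OneForm M) (ξ : VField M) (φ : EndField M) (g : Metric M) :
    Prop where
  contact : IsContactForm η
  smooth_xi : ξ.IsSmooth
  smooth_phi : φ.IsSmooth
  unit_xi : ∀ x, g.inner x (ξ x) (ξ x) = 1
  eta_xi : ∀ x, η x (ξ x) = 1
  phi_sq : ∀ x (v : TangentSpace (𝓡 3) x), φ x (φ x v) = -v + η x v • ξ x
  phi_xi : ∀ x, φ x (ξ x) = 0
  associated : IsAssociated η φ g

/-- The operator `h = (1/2) L_ξ φ` on vector fields:
`h X = (1/2) ([ξ, φ X] - φ [ξ, X])`. -/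
noncomputable def hOp (ξ : VField M) (φ : EndField M) (X : VField M) : VField M := fun x =>
  (1 / 2 : ℝ) • (bracket ξ (fun y => φ y (X y)) x - φ x (bracket ξ X x))

/-- `nabla` is the Levi-Civita connection of `g`: it is torsion free and metric. By the fundamental
theorem of Riemannian geometry it exists and is unique (on differentiable vector fields). -/
def IsLeviCivita (g : Metric M) (nabla : Connection M) : Prop :=
  nabla.torsion = 0 ∧
    ∀ (Y Z : VField M) (x : M),
      MDifferentiableAt (𝓡 3) (𝓡 3).tangent (fun y => (⟨y, Y y⟩ : TangentBundle (𝓡 3) M)) x →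
      MDifferentiableAt (𝓡 3) (𝓡 3).tangent (fun y => (⟨y, Z y⟩ : TangentBundle (𝓡 3) M)) x →
      ∀ v : TangentSpace (𝓡 3) x,
        mvfderiv (𝓡 3) (fun y => g.inner y (Y y) (Z y)) x v =
          g.inner x (nabla Y x v) (Z x) + g.inner x (Y x) (nabla Z x v)

/-- The curvature `R(X, Y) Z = ∇_X ∇_Y Z - ∇_Y ∇_X Z - ∇_[X, Y] Z`. -/
noncomputable def curvature (nabla : Connection M) (X Y Z : VField M) : VField M := fun x =>
  nabla (fun y => nabla Z y (Y y)) x (X x) - nabla (fun y => nabla Z y (X y)) x (Y x)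
    - nabla Z x (bracket X Y x)

/-- The metric `g` is flat: the curvature of its Levi-Civita connection vanishes. -/
def IsFlat (g : Metric M) : Prop :=
  ∃ nabla : Connection M, IsLeviCivita g nabla ∧
    ∀ X Y Z : VField M, X.IsSmooth → Y.IsSmooth → Z.IsSmooth → ∀ x, curvature nabla X Y Z x = 0

/-- `(M, η, ξ, φ, g)` is a generalized Jacobi `(κ, μ)`-structure: a contact metric structure whose
curvature satisfies `R(X, ξ) ξ = κ (X - η(X) ξ) + μ h X`, with `κ` and `μ` smooth functions. -/
def IsGeneralizedJacobi (η : OneForm M) (ξ : VField M) (φ : EndField M) (g : Metric M)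
    (κ μ : M → ℝ) : Prop :=
  IsContactMetric η ξ φ g ∧
  ContMDiff (𝓡 3) 𝓘(ℝ) ∞ κ ∧ ContMDiff (𝓡 3) 𝓘(ℝ) ∞ μ ∧
  ∃ nabla : Connection M, IsLeviCivita g nabla ∧
    ∀ X : VField M, X.IsSmooth → ∀ x,
      curvature nabla X ξ ξ x = κ x • (X x - η x (X x) • ξ x) + μ x • hOp ξ φ X x

/-- The values, on the frame `E, φE, ξ`, of the metric deformed by the function `f`. -/
structure IsDeformedMetric (ξ : VField M) (φ : EndField M) (E : VField M) (f : M → ℝ)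
    (gf : Metric M) : Prop where
  E_E : ∀ x, gf.inner x (E x) (E x) = 1 + f x + f x ^ 2 / 2
  phiE_phiE : ∀ x, gf.inner x (φ x (E x)) (φ x (E x)) = 1 - f x + f x ^ 2 / 2
  E_phiE : ∀ x, gf.inner x (E x) (φ x (E x)) = f x ^ 2 / 2
  xi_E : ∀ x, gf.inner x (ξ x) (E x) = 0
  xi_phiE : ∀ x, gf.inner x (ξ x) (φ x (E x)) = 0
  xi_xi : ∀ x, gf.inner x (ξ x) (ξ x) = 1

end Definitions

end ContactThree

/-! Flatness fixes the brackets of the frame `ξ`, `E`, `F = φE`. The contact conditions, `hE = E`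
and the Jacobi identity leave `[ξ, E] = qF` and `[ξ, F] = pE` with `p + q = 2`. The Koszul formula
then yields `∇ξ = -2 g(E, ·) F`, and `R(E, ξ)ξ = 0` and `R(E, F)ξ = 0` force `[ξ, E] = 2F`, `[ξ, F]
= 0`, `[E, F] = 2ξ`, the Lie algebra of plane motions (`IsContactMetric.isFlatContactFrame`).

The deformation is best understood for an arbitrary symmetric matrix `A = (a, c; c, d)` on the span
of `E`, `F` with `det A = 1`, `a > 0`, and entries constant along `ξ`. If `J` is the rotation `E ↦ F
↦ -E`, then `AJA = det A · J = J`, so `JA` is the associated endomorphism and squares to `-1` on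
that plane (`isAssociated`, `isContactMetric`). Since `∇_ξ ξ = 0`, absence of torsion turns `R(X,
ξ)ξ` into `-(T² + L_ξ T)X` with `T = ∇ξ`, so no other covariant derivatives are needed. Along `ξ`
the coefficients are constant and the bracket acts on the frame by a fixed nilpotent matrix, so what
remains is matrix algebra, with result `κ = 1 - d²`, `μ = 2(1 - d)` (`curvature_xi`). The
proposition is the case `d = 1 - f + f²/2`.

The Levi-Civita connection of the new metric has to be constructed as well: the torsion free
connection supplied by flatness is corrected by a symmetric tensor (`exists_isLeviCivita`). -/

namespace ContactThree

/-! ### Smoothness of fields built from smooth fields -/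

section Smoothness

variable {M : Type*} [TopologicalSpace M] [ChartedSpace (EuclideanSpace ℝ (Fin 3)) M]
  [IsManifold (𝓡 3) ∞ M]

lemma VField.IsSmooth.mdifferentiableAt {X : VField M} (hX : X.IsSmooth) (x : M) :
    MDifferentiableAt (𝓡 3) (𝓡 3).tangent (fun y => (⟨y, X y⟩ : TangentBundle (𝓡 3) M)) x :=
  ContMDiff.mdifferentiable hX (by simp) x

lemma VField.IsSmooth.add {X Y : VField M} (hX : X.IsSmooth) (hY : Y.IsSmooth) :
    VField.IsSmooth (X + Y) :=
  ContMDiff.add_section hX hY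

lemma VField.IsSmooth.smul {f : M → ℝ} {X : VField M} (hf : ContMDiff (𝓡 3) 𝓘(ℝ) ∞ f)
    (hX : X.IsSmooth) : VField.IsSmooth (f • X) :=
  ContMDiff.smul_section hf hX

lemma EndField.IsSmooth.apply {A : EndField M} {X : VField M} (hA : A.IsSmooth)
    (hX : X.IsSmooth) : VField.IsSmooth (fun x => A x (X x)) :=
  ContMDiff.clm_bundle_apply hA hX

lemma OneForm.IsSmooth.apply {α : OneForm M} {X : VField M} (hα : α.IsSmooth)
    (hX : X.IsSmooth) : ContMDiff (𝓡 3) 𝓘(ℝ) ∞ (fun x => α x (X x)) := by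
  have h := ContMDiff.clm_bundle_apply (F₂ := ℝ) (E₂ := Bundle.Trivial M ℝ) hα hX
  intro x
  exact (contMDiffAt_totalSpace.1 (h x)).2

lemma Metric.flat_isSmooth (g : Metric M) {X : VField M} (hX : X.IsSmooth) :
    OneForm.IsSmooth (fun x => g.inner x (X x)) :=
  ContMDiff.clm_bundle_apply (F₂ := EuclideanSpace ℝ (Fin 3) →L[ℝ] ℝ) g.contMDiff hX

lemma Metric.inner_contMDiff (g : Metric M) {X Y : VField M} (hX : X.IsSmooth)
    (hY : Y.IsSmooth) : ContMDiff (𝓡 3) 𝓘(ℝ) ∞ (fun x => g.inner x (X x) (Y x)) :=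
  (g.flat_isSmooth hX).apply hY

lemma Metric.inner_mdifferentiableAt (g : Metric M) {X Y : VField M} {x : M}
    (hX : MDifferentiableAt (𝓡 3) (𝓡 3).tangent (fun y => (⟨y, X y⟩ : TangentBundle (𝓡 3) M)) x)
    (hY : MDifferentiableAt (𝓡 3) (𝓡 3).tangent (fun y => (⟨y, Y y⟩ : TangentBundle (𝓡 3) M)) x) :
    MDifferentiableAt (𝓡 3) 𝓘(ℝ) (fun x => g.inner x (X x) (Y x)) x := by
  have h := MDifferentiableAt.clm_bundle_apply₂ (F₃ := ℝ) (E₃ := Bundle.Trivial M ℝ)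
    (g.contMDiff.mdifferentiable (by simp) x) hX hY
  exact ((mdifferentiableAt_totalSpace ..).1 h).2

lemma bracket_isSmooth {X Y : VField M} (hX : X.IsSmooth) (hY : Y.IsSmooth) :
    (bracket X Y).IsSmooth := by
  -- The bracket costs one derivative, which is harmless because `∞ + 1 = ∞`.
  have : IsManifold (𝓡 3) (((⊤ : ℕ∞) : WithTop ℕ∞) + 1) M := by simpa
  have : IsManifold (𝓡 3) (minSmoothness ℝ 2) M := by
    rw [minSmoothness_of_isRCLikeNormedField]; infer_instance
  exact ContDiff.mlieBracket_vectorField (n := ⊤) (m := ⊤) hX hY (by simp)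

end Smoothness

/-! ### Rank-one bundle homomorphisms -/

section SmulRight

variable {B : Type*} [TopologicalSpace B]
  {EB HB : Type*} [NormedAddCommGroup EB] [NormedSpace ℝ EB] [TopologicalSpace HB]
  {IB : ModelWithCorners ℝ EB HB} [ChartedSpace HB B] {n : WithTop ℕ∞}
  {F₁ F₂ : Type*} [NormedAddCommGroup F₁] [NormedSpace ℝ F₁]
  [NormedAddCommGroup F₂] [NormedSpace ℝ F₂]
  {E₁ E₂ : B → Type*}
  [∀ x, AddCommGroup (E₁ x)] [∀ x, Module ℝ (E₁ x)] [∀ x, TopologicalSpace (E₁ x)]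
  [∀ x, AddCommGroup (E₂ x)] [∀ x, Module ℝ (E₂ x)] [∀ x, TopologicalSpace (E₂ x)]
  [TopologicalSpace (TotalSpace F₁ E₁)] [TopologicalSpace (TotalSpace F₂ E₂)]
  [FiberBundle F₁ E₁] [VectorBundle ℝ F₁ E₁] [FiberBundle F₂ E₂] [VectorBundle ℝ F₂ E₂]
  [∀ x, IsTopologicalAddGroup (E₂ x)] [∀ x, ContinuousSMul ℝ (E₂ x)]

/-- Near the base point, the coordinate expression of the tensor product is `smulRight` of the two
coordinate expressions, a bounded bilinear operation. Deformed metrics and endomorphisms are sums of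
such terms. -/
lemma contMDiff_smulRight {α : Π x : B, E₁ x →L[ℝ] ℝ} {v : Π x : B, E₂ x}
    (hα : ContMDiff IB (IB.prod 𝓘(ℝ, F₁ →L[ℝ] ℝ)) n
      (fun x => TotalSpace.mk' (F₁ →L[ℝ] ℝ)
        (E := fun x : B => E₁ x →L[ℝ] Bundle.Trivial B ℝ x) x (α x)))
    (hv : ContMDiff IB (IB.prod 𝓘(ℝ, F₂)) n (fun x => TotalSpace.mk' F₂ x (v x))) :
    ContMDiff IB (IB.prod 𝓘(ℝ, F₁ →L[ℝ] F₂)) n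
      (fun x => TotalSpace.mk' (F₁ →L[ℝ] F₂) (E := fun x : B => E₁ x →L[ℝ] E₂ x) x
        ((α x).smulRight (v x))) := by
  intro x₀
  rw [contMDiffAt_hom_bundle]
  refine ⟨contMDiffAt_id, ?_⟩
  have h1 := ((contMDiffAt_hom_bundle _).1 (hα x₀)).2
  have h2 := (contMDiffAt_totalSpace.1 (hv x₀)).2
  have h3 := ((ContinuousLinearMap.smulRightL ℝ F₁ F₂).isBoundedBilinearMap.contDiff
    (n := n)).contMDiff.contMDiffAt.comp x₀ (h1.prodMk_space h2)
  refine h3.congr_of_eventuallyEq ?_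
  have hb2 := (trivializationAt F₂ E₂ x₀).open_baseSet.mem_nhds
    (FiberBundle.mem_baseSet_trivializationAt' x₀)
  filter_upwards [hb2] with x hx
  ext w
  simp [ContinuousLinearMap.inCoordinates, hx, Trivialization.linearMapAt_apply]

end SmulRight

/-! ### The algebra behind the Koszul formula -/

section LinearAlgebra

variable {V : Type*} [AddCommGroup V] [Module ℝ V] [TopologicalSpace V] [IsTopologicalAddGroup V]
  [ContinuousSMul ℝ V] [T2Space V] [FiniteDimensional ℝ V]

/-- The algebraic part of the fundamental theorem of Riemannian geometry. -/
lemma exists_koszul_solution (b : V →L[ℝ] V →L[ℝ] ℝ) (hb : ∀ v w, (∀ u, b v u = b w u) → v = w)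
    (S : V →L[ℝ] V →L[ℝ] V →L[ℝ] ℝ) :
    ∃ A : V →L[ℝ] V →L[ℝ] V, ∀ w v u,
      b (A w v) u = 1 / 2 * (S w u v + S v u w - S v w u) := by
  let b' : V →ₗ[ℝ] Module.Dual ℝ V := (ContinuousLinearMap.coeLM ℝ) ∘ₗ b.toLinearMap
  let e : V ≃ₗ[ℝ] Module.Dual ℝ V := LinearEquiv.ofInjectiveOfFinrankEq b'
    (fun v w h => hb v w fun u => congr($h u)) Subspace.dual_finrank_eq.symm
  let S' : V →ₗ[ℝ] V →ₗ[ℝ] V →ₗ[ℝ] ℝ :=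
    ((ContinuousLinearMap.coeLM ℝ) ∘ₗ S.toLinearMap).compr₂ (ContinuousLinearMap.coeLM ℝ)
  -- `P w v u = S w u v`; its flip and that of `S'` supply the other two terms of the cyclic
  -- combination.
  let P : V →ₗ[ℝ] V →ₗ[ℝ] V →ₗ[ℝ] ℝ := LinearMap.lflip.toLinearMap ∘ₗ S'
  let T : V →ₗ[ℝ] V →ₗ[ℝ] V →ₗ[ℝ] ℝ := (1 / 2 : ℝ) • (P + P.flip + (-1 : ℝ) • S'.flip)
  let A : V →ₗ[ℝ] V →ₗ[ℝ] V := T.compr₂ e.symm.toLinearMap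
  refine ⟨LinearMap.toContinuousLinearMap (LinearMap.toContinuousLinearMap.toLinearMap ∘ₗ A),
    fun w v u => ?_⟩
  have h : b' (A w v) = T w v := e.apply_symm_apply _
  have h' : b (A w v) u = 1 / 2 * (S w u v + S v u w + -1 * S v w u) := congr($h u)
  rw [neg_one_mul, ← sub_eq_add_neg] at h'
  exact h'

end LinearAlgebra

/-! ### Existence of the Levi-Civita connection and the Koszul formula -/

section LeviCivita

variable {M : Type*} [TopologicalSpace M] [ChartedSpace (EuclideanSpace ℝ (Fin 3)) M]
  [IsManifold (𝓡 3) ∞ M]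

instance (x : M) : FiniteDimensional ℝ (TangentSpace (𝓡 3) x) :=
  inferInstanceAs (FiniteDimensional ℝ (EuclideanSpace ℝ (Fin 3)))

instance (x : M) : T2Space (TangentSpace (𝓡 3) x) :=
  inferInstanceAs (T2Space (EuclideanSpace ℝ (Fin 3)))

lemma Metric.eq_of_inner_eq (g : Metric M) {x : M} {v w : TangentSpace (𝓡 3) x}
    (h : ∀ u, g.inner x v u = g.inner x w u) : v = w := by
  by_contra hne
  have hp := g.pos x (v - w) (sub_ne_zero.2 hne)
  rw [(g.inner x).map_sub, sub_apply, h, sub_self] at hp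
  exact lt_irrefl _ hp

/-- `v g(Y, Z) - g(∇_v Y, Z) - g(Y, ∇_v Z)`. -/
noncomputable def metricDefect (g : Metric M) (nabla : Connection M) (Y Z : VField M) (x : M) :
    TangentSpace (𝓡 3) x →L[ℝ] ℝ :=
  mvfderiv (𝓡 3) (fun y => g.inner y (Y y) (Z y)) x - (g.inner x (Z x)).comp (nabla Y x)
    - (g.inner x (Y x)).comp (nabla Z x)

/-- The term `df(v) g(Y, Z)` from the product rule cancels against the one from the Leibniz rule of
the connection. -/
lemma metricDefect_tensorial_left (g : Metric M) (nabla : Connection M) (Z : VField M) {x : M}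
    (hZ : MDifferentiableAt (𝓡 3) (𝓡 3).tangent
      (fun y => (⟨y, Z y⟩ : TangentBundle (𝓡 3) M)) x) :
    TensorialAt (𝓡 3) (EuclideanSpace ℝ (Fin 3)) (metricDefect g nabla · Z x) x where
  smul hf hY := by
    ext v
    simp [metricDefect, mvfderiv_fun_mul hf (g.inner_mdifferentiableAt hY hZ),
      nabla.isCovariantDerivativeOn.leibniz hY hf, g.symm x (Z x)]
    ring
  add hY hY' := by
    ext v
    simp [metricDefect, mvfderiv_fun_add (g.inner_mdifferentiableAt hY hZ)
      (g.inner_mdifferentiableAt hY' hZ), nabla.isCovariantDerivativeOn.add hY hY']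
    ring

lemma metricDefect_symm (g : Metric M) (nabla : Connection M) (Y Z : VField M) (x : M) :
    metricDefect g nabla Y Z x = metricDefect g nabla Z Y x := by
  simp only [metricDefect, g.symm _ (Y _) (Z _)]
  abel

/-- `metricDefect` as a tensor. -/
noncomputable def metricDefectTensor (g : Metric M) (nabla : Connection M) (x : M) :
    TangentSpace (𝓡 3) x →L[ℝ] TangentSpace (𝓡 3) x →L[ℝ] (TangentSpace (𝓡 3) x →L[ℝ] ℝ) :=
  TensorialAt.mkHom₂ (I := 𝓡 3) (F := EuclideanSpace ℝ (Fin 3))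
    (F' := EuclideanSpace ℝ (Fin 3)) (metricDefect g nabla · · x) x
    (fun Z hZ => metricDefect_tensorial_left g nabla Z hZ)
    (fun Y hY => by
      simpa only [metricDefect_symm g nabla Y] using metricDefect_tensorial_left g nabla Y hY)

lemma metricDefectTensor_apply (g : Metric M) (nabla : Connection M) {x : M} {Y Z : VField M}
    (hY : MDifferentiableAt (𝓡 3) (𝓡 3).tangent (fun y => (⟨y, Y y⟩ : TangentBundle (𝓡 3) M)) x)
    (hZ : MDifferentiableAt (𝓡 3) (𝓡 3).tangent (fun y => (⟨y, Z y⟩ : TangentBundle (𝓡 3) M)) x) :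
    metricDefectTensor g nabla x (Y x) (Z x) = metricDefect g nabla Y Z x :=
  TensorialAt.mkHom₂_apply _ _ hY hZ

lemma metricDefectTensor_symm (g : Metric M) (nabla : Connection M) (x : M)
    (v w : TangentSpace (𝓡 3) x) :
    metricDefectTensor g nabla x v w = metricDefectTensor g nabla x w v :=
  metricDefect_symm ..

/-- The difference between the Levi-Civita connection and a torsion free connection. -/
noncomputable def leviCivitaCorrection (g : Metric M) (nabla : Connection M) (x : M) :
    TangentSpace (𝓡 3) x →L[ℝ] TangentSpace (𝓡 3) x →L[ℝ] TangentSpace (𝓡 3) x :=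
  (exists_koszul_solution (g.inner x) (fun _ _ => g.eq_of_inner_eq)
    (metricDefectTensor g nabla x)).choose

lemma inner_leviCivitaCorrection (g : Metric M) (nabla : Connection M) (x : M)
    (v w u : TangentSpace (𝓡 3) x) :
    g.inner x (leviCivitaCorrection g nabla x w v) u =
      1 / 2 * (metricDefectTensor g nabla x w u v + metricDefectTensor g nabla x v u w
        - metricDefectTensor g nabla x v w u) :=
  (exists_koszul_solution (g.inner x) (fun _ _ => g.eq_of_inner_eq)
    (metricDefectTensor g nabla x)).choose_spec w v u

/-- The correction is symmetric in its two arguments, because the defect is symmetric, so the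
torsion stays zero. In `g(A(Y, v), Z) + g(Y, A(Z, v))` the mixed Koszul terms cancel, leaving
exactly the defect. -/
theorem exists_isLeviCivita (g : Metric M) (nabla : Connection M) (h : nabla.torsion = 0) :
    ∃ nabla' : Connection M, IsLeviCivita g nabla' := by
  refine ⟨nabla.addOneForm (leviCivitaCorrection g nabla), ?_, fun Y Z x hY hZ v => ?_⟩
  · rw [CovariantDerivative.torsion_eq_zero_iff] at h ⊢
    intro X Y x hX hY
    rw [← h hX hY]
    have : leviCivitaCorrection g nabla x (X x) (Y x)
        = leviCivitaCorrection g nabla x (Y x) (X x) := by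
      refine g.eq_of_inner_eq fun u => ?_
      rw [inner_leviCivitaCorrection, inner_leviCivitaCorrection,
        metricDefectTensor_symm g nabla x (X x) (Y x)]
      ring
    simp [CovariantDerivative.addOneForm, this]
  · have h1 := inner_leviCivitaCorrection g nabla x v (Y x) (Z x)
    have h2 := inner_leviCivitaCorrection g nabla x v (Z x) (Y x)
    have h3 := congr($(metricDefectTensor_apply g nabla hY hZ) v)
    rw [metricDefectTensor_symm g nabla x (Z x) (Y x)] at h2
    simp only [metricDefect, sub_apply, ContinuousLinearMap.comp_apply] at h3
    rw [g.symm x (Z x)] at h3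
    simp only [CovariantDerivative.addOneForm, add_apply, map_add]
    rw [g.symm x (Y x) (leviCivitaCorrection g nabla x (Z x) v)]
    rw [h1, h2]
    linarith

/-- The Koszul formula. -/
lemma IsLeviCivita.koszul {g : Metric M} {nabla : Connection M} (h : IsLeviCivita g nabla)
    {X Y Z : VField M} (hX : X.IsSmooth) (hY : Y.IsSmooth) (hZ : Z.IsSmooth) (x : M) :
    2 * g.inner x (nabla Y x (X x)) (Z x) =
      mvfderiv (𝓡 3) (fun y => g.inner y (Y y) (Z y)) x (X x)
        + mvfderiv (𝓡 3) (fun y => g.inner y (X y) (Z y)) x (Y x)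
        - mvfderiv (𝓡 3) (fun y => g.inner y (X y) (Y y)) x (Z x)
        + g.inner x (bracket X Y x) (Z x) - g.inner x (bracket Y Z x) (X x)
        - g.inner x (bracket X Z x) (Y x) := by
  have hX' := hX.mdifferentiableAt x
  have hY' := hY.mdifferentiableAt x
  have hZ' := hZ.mdifferentiableAt x
  have ht {U V : VField M} (hU : U.IsSmooth) (hV : V.IsSmooth) :=
    nabla.torsion_eq_zero_iff.1 h.1 (hU.mdifferentiableAt x) (hV.mdifferentiableAt x)
  simp only [bracket]
  rw [h.2 Y Z x hY' hZ', h.2 X Z x hX' hZ', h.2 X Y x hX' hY', ← ht hX hY, ← ht hY hZ,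
    ← ht hX hZ]
  simp only [map_sub, sub_apply, g.symm x (X x) (nabla _ _ _), g.symm x (Y x) (nabla _ _ _)]
  ring

lemma IsLeviCivita.apply_eq {g : Metric M} {nabla : Connection M} (h : IsLeviCivita g nabla)
    {X Y : VField M} (hX : X.IsSmooth) (hY : Y.IsSmooth) (x : M) :
    nabla Y x (X x) = nabla X x (Y x) + bracket X Y x := by
  rw [bracket, ← nabla.torsion_eq_zero_iff.1 h.1 (hX.mdifferentiableAt x) (hY.mdifferentiableAt x)]
  abel

end LeviCivita

/-! ### Brackets and global orthonormal frames -/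

section Frames

variable {M : Type*} [TopologicalSpace M] [ChartedSpace (EuclideanSpace ℝ (Fin 3)) M]

lemma mvfderiv_eq_zero_of_forall_eq {f : M → ℝ} {c : ℝ} (h : ∀ y, f y = c) (x : M)
    (v : TangentSpace (𝓡 3) x) : mvfderiv (𝓡 3) f x v = 0 := by
  obtain rfl : f = fun _ => c := funext h
  simp [mvfderiv]

lemma bracket_swap_apply (X Y : VField M) (x : M) : bracket X Y x = -bracket Y X x :=
  VectorField.mlieBracket_swap_apply

lemma bracket_self_apply (X : VField M) (x : M) : bracket X X x = 0 := by
  simp [bracket]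

lemma dForm_swap (α : OneForm M) (X Y : VField M) (x : M) :
    dForm α X Y x = -dForm α Y X x := by
  simp only [dForm, bracket_swap_apply X Y, map_neg]
  ring

variable [IsManifold (𝓡 3) ∞ M]

lemma bracket_jacobi {X Y Z : VField M} (hX : X.IsSmooth) (hY : Y.IsSmooth) (hZ : Z.IsSmooth)
    (x : M) :
    bracket X (bracket Y Z) x = bracket (bracket X Y) Z x + bracket Y (bracket X Z) x := by
  have : IsManifold (𝓡 3) (minSmoothness ℝ 3) M := by
    rw [minSmoothness_of_isRCLikeNormedField]; infer_instance
  have h {U : VField M} (hU : U.IsSmooth) : ContMDiffAt (𝓡 3) (𝓡 3).tangent (minSmoothness ℝ 2)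
      (fun y => (⟨y, U y⟩ : TangentBundle (𝓡 3) M)) x := by
    rw [minSmoothness_of_isRCLikeNormedField]
    exact (hU x).of_le ENat.LEInfty.out
  exact VectorField.leibniz_identity_mlieBracket_apply (h hX) (h hY) (h hZ)

/-- A global smooth `g`-orthonormal frame. -/
structure Metric.IsOrthonormalFrame (g : Metric M) (ξ E F : VField M) : Prop where
  smooth_xi : ξ.IsSmooth
  smooth_E : E.IsSmooth
  smooth_F : F.IsSmooth
  xi_xi : ∀ x, g.inner x (ξ x) (ξ x) = 1
  E_E : ∀ x, g.inner x (E x) (E x) = 1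
  F_F : ∀ x, g.inner x (F x) (F x) = 1
  xi_E : ∀ x, g.inner x (ξ x) (E x) = 0
  xi_F : ∀ x, g.inner x (ξ x) (F x) = 0
  E_F : ∀ x, g.inner x (E x) (F x) = 0

namespace Metric.IsOrthonormalFrame

variable {g : Metric M} {ξ E F : VField M} (h : g.IsOrthonormalFrame ξ E F)
include h

lemma E_xi (x : M) : g.inner x (E x) (ξ x) = 0 := by rw [g.symm, h.xi_E]

lemma F_xi (x : M) : g.inner x (F x) (ξ x) = 0 := by rw [g.symm, h.xi_F]

lemma F_E (x : M) : g.inner x (F x) (E x) = 0 := by rw [g.symm, h.E_F]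

lemma eq_sum (x : M) (v : TangentSpace (𝓡 3) x) :
    v = g.inner x (E x) v • E x + g.inner x (F x) v • F x + g.inner x (ξ x) v • ξ x := by
  have hli : LinearIndependent ℝ ![E x, F x, ξ x] := by
    rw [Fintype.linearIndependent_iff]
    intro c hc
    simp only [Fin.sum_univ_three, Matrix.cons_val] at hc
    have h1 := congr(g.inner x (E x) $hc)
    have h2 := congr(g.inner x (F x) $hc)
    have h3 := congr(g.inner x (ξ x) $hc)
    simp [h.E_E, h.E_F, h.E_xi, h.F_E, h.F_F, h.F_xi, h.xi_E, h.xi_F, h.xi_xi] at h1 h2 h3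
    intro i
    fin_cases i <;> simpa
  have hspan := hli.span_eq_top_of_card_eq_finrank
    (by simp [show Module.finrank ℝ (TangentSpace (𝓡 3) x) = 3 from finrank_euclideanSpace_fin])
  obtain ⟨c, rfl⟩ := (Submodule.mem_span_range_iff_exists_fun ℝ).1
    (hspan ▸ Submodule.mem_top : v ∈ Submodule.span ℝ (Set.range ![E x, F x, ξ x]))
  simp [Fin.sum_univ_three, h.E_E, h.E_F, h.E_xi, h.F_E, h.F_F, h.F_xi, h.xi_E, h.xi_F, h.xi_xi]

lemma ext {x : M} {v w : TangentSpace (𝓡 3) x} (hE : g.inner x (E x) v = g.inner x (E x) w)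
    (hF : g.inner x (F x) v = g.inner x (F x) w) (hxi : g.inner x (ξ x) v = g.inner x (ξ x) w) :
    v = w := by
  rw [h.eq_sum x v, h.eq_sum x w, hE, hF, hxi]

end Metric.IsOrthonormalFrame

lemma IsLeviCivita.koszul_const {g : Metric M} {nabla : Connection M} (h : IsLeviCivita g nabla)
    {X Y Z : VField M} (hX : X.IsSmooth) (hY : Y.IsSmooth) (hZ : Z.IsSmooth) {a b c : ℝ}
    (hYZ : ∀ x, g.inner x (Y x) (Z x) = a) (hXZ : ∀ x, g.inner x (X x) (Z x) = b)
    (hXY : ∀ x, g.inner x (X x) (Y x) = c) (x : M) :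
    2 * g.inner x (Z x) (nabla Y x (X x)) =
      g.inner x (Z x) (bracket X Y x) - g.inner x (X x) (bracket Y Z x)
        - g.inner x (Y x) (bracket X Z x) := by
  rw [g.symm, h.koszul hX hY hZ, mvfderiv_eq_zero_of_forall_eq hYZ,
    mvfderiv_eq_zero_of_forall_eq hXZ, mvfderiv_eq_zero_of_forall_eq hXY,
    g.symm x _ (Z x), g.symm x _ (X x), g.symm x _ (Y x)]
  ring

end Frames

/-! ### The frame of a flat contact metric structure -/

section FlatContact

variable {M : Type*} [TopologicalSpace M] [ChartedSpace (EuclideanSpace ℝ (Fin 3)) M]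
  [IsManifold (𝓡 3) ∞ M]

namespace IsContactMetric

variable {η : OneForm M} {ξ : VField M} {φ : EndField M} {g : Metric M}
  (h : IsContactMetric η ξ φ g)
include h

/-- Evaluating `φ³v` as `φ²(φv)` and as `φ(φ²v)` leaves `η(φv) ξ = 0`. -/
lemma eta_phi (x : M) (v : TangentSpace (𝓡 3) x) : η x (φ x v) = 0 := by
  have h1 := h.phi_sq x (φ x v)
  have h2 := congr(φ x $(h.phi_sq x v))
  rw [h1, map_add, map_smul, h.phi_xi, smul_zero, map_neg, add_zero, add_eq_left] at h2
  have h3 := congr(η x $h2)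
  simpa [h.eta_xi] using h3

lemma inner_phi_swap {X Y : VField M} (hX : X.IsSmooth) (hY : Y.IsSmooth) (x : M) :
    g.inner x (X x) (φ x (Y x)) = -g.inner x (Y x) (φ x (X x)) := by
  have h1 := h.associated X Y hX hY x
  have h2 := h.associated Y X hY hX x
  rw [dForm_swap] at h1
  linarith

lemma inner_xi_phi {Y : VField M} (hY : Y.IsSmooth) (x : M) :
    g.inner x (ξ x) (φ x (Y x)) = 0 := by
  rw [h.inner_phi_swap h.smooth_xi hY, h.phi_xi, map_zero, neg_zero]

/-- Since `ξ` is orthogonal to the image of `φ`, pairing it with `φ²Y = -Y + η(Y) ξ` gives zero. -/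
lemma inner_xi {Y : VField M} (hY : Y.IsSmooth) (x : M) : g.inner x (ξ x) (Y x) = η x (Y x) := by
  have h1 := h.inner_xi_phi (h.smooth_phi.apply hY) x
  rw [h.phi_sq, map_add, map_neg, map_smul, h.unit_xi, smul_eq_mul, mul_one] at h1
  linarith

lemma eta_bracket {X Y : VField M} (hX : X.IsSmooth) (hY : Y.IsSmooth) {a b : ℝ}
    (ha : ∀ x, η x (X x) = a) (hb : ∀ x, η x (Y x) = b) (x : M) :
    η x (bracket X Y x) = -2 * g.inner x (X x) (φ x (Y x)) := by
  have h1 := h.associated X Y hX hY x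
  rw [dForm, mvfderiv_eq_zero_of_forall_eq ha, mvfderiv_eq_zero_of_forall_eq hb] at h1
  linarith

lemma eta_bracket_xi {Y : VField M} (hY : Y.IsSmooth) {b : ℝ}
    (hb : ∀ x, η x (Y x) = b) (x : M) : η x (bracket ξ Y x) = 0 := by
  rw [h.eta_bracket h.smooth_xi hY h.eta_xi hb, h.inner_xi_phi hY, mul_zero]

variable {E : VField M} (hE_smooth : E.IsSmooth) (hE : ∀ x, hOp ξ φ E x = E x)
include hE_smooth hE

/-- The image of `h` lies in the kernel of `η`: `φ` maps into it, and bracketing with `ξ` preserves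
it. -/
lemma eta_eq_zero_of_hOp (x : M) : η x (E x) = 0 := by
  rw [← hE, hOp, map_smul, map_sub, h.eta_phi,
    h.eta_bracket_xi (h.smooth_phi.apply hE_smooth) (fun x => h.eta_phi x _)]
  simp

lemma phi_phi_E (x : M) : φ x (φ x (E x)) = -E x := by
  rw [h.phi_sq, h.eta_eq_zero_of_hOp hE_smooth hE]; simp

variable (hE_unit : ∀ x, g.inner x (E x) (E x) = 1)
include hE_unit

lemma isOrthonormalFrame : g.IsOrthonormalFrame ξ E (fun x => φ x (E x)) where
  smooth_xi := h.smooth_xi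
  smooth_E := hE_smooth
  smooth_F := h.smooth_phi.apply hE_smooth
  xi_xi := h.unit_xi
  E_E := hE_unit
  F_F x := by
    have h1 := h.inner_phi_swap (h.smooth_phi.apply hE_smooth) hE_smooth x
    rw [h1, h.phi_sq, h.eta_eq_zero_of_hOp hE_smooth hE]
    simp [hE_unit]
  xi_E x := by rw [h.inner_xi hE_smooth, h.eta_eq_zero_of_hOp hE_smooth hE]
  xi_F := h.inner_xi_phi hE_smooth
  E_F x := by
    have h1 := h.inner_phi_swap hE_smooth hE_smooth x
    linarith

end IsContactMetric

/-- A global orthonormal frame adapted to a flat contact metric structure. -/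
structure IsFlatContactFrame (η : OneForm M) (g : Metric M) (ξ E F : VField M) : Prop
    extends g.IsOrthonormalFrame ξ E F where
  eta_eq : ∀ x v, η x v = g.inner x (ξ x) v
  dForm_eq : ∀ X Y : VField M, X.IsSmooth → Y.IsSmooth → ∀ x,
    dForm η X Y x = 2 * (g.inner x (F x) (X x) * g.inner x (E x) (Y x)
      - g.inner x (E x) (X x) * g.inner x (F x) (Y x))
  bracket_xi_E : ∀ x, bracket ξ E x = (2 : ℝ) • F x
  bracket_xi_F : ∀ x, bracket ξ F x = 0
  bracket_E_F : ∀ x, bracket E F x = (2 : ℝ) • ξ x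

/-- `∇ξ` depends on the two unknown coefficients `p = g(E, [ξ, F])` and `q = g(F, [ξ, E])` only
through `p + q = 2`, so it is known before flatness is used. The curvature equations then determine
the brackets. -/
theorem IsContactMetric.isFlatContactFrame {η : OneForm M} {ξ : VField M} {φ : EndField M}
    {g : Metric M} (h : IsContactMetric η ξ φ g) (hflat : IsFlat g)
    {E : VField M} (hE_smooth : E.IsSmooth) (hE : ∀ x, hOp ξ φ E x = E x)
    (hE_unit : ∀ x, g.inner x (E x) (E x) = 1) :
    IsFlatContactFrame η g ξ E (fun x => φ x (E x)) := by
  set F : VField M := fun x => φ x (E x) with hF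
  have fr : g.IsOrthonormalFrame ξ E F := h.isOrthonormalFrame hE_smooth hE hE_unit
  have hFx (x : M) : φ x (E x) = F x := rfl
  have hφF (x : M) : φ x (F x) = -E x := h.phi_phi_E hE_smooth hE x
  have ηE (x : M) : η x (E x) = 0 := h.eta_eq_zero_of_hOp hE_smooth hE x
  have ηF (x : M) : η x (F x) = 0 := h.eta_phi x _
  have eta_eq (x : M) (v : TangentSpace (𝓡 3) x) : η x v = g.inner x (ξ x) v := by
    conv_lhs => rw [fr.eq_sum x v]
    simp [ηE, ηF, h.eta_xi]
  have sE := fr.smooth_E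
  have sF := fr.smooth_F
  have sξ := fr.smooth_xi
  have s1 := bracket_isSmooth sξ sE
  have s2 := bracket_isSmooth sξ sF
  have s3 := bracket_isSmooth sE sF
  -- Components of the brackets along `ξ`.
  have c1 (x : M) : η x (bracket ξ E x) = 0 := h.eta_bracket_xi sE ηE x
  have c2 (x : M) : η x (bracket ξ F x) = 0 := h.eta_bracket_xi sF ηF x
  have c3 (x : M) : η x (bracket E F x) = 2 := by
    rw [h.eta_bracket sE sF ηE ηF, hφF, map_neg, hE_unit]; norm_num
  -- `[ξ, E]` has no `E`-component and `[ξ, F]` has no `F`-component.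
  have hjac (x : M) : g.inner x (E x) (bracket ξ E x) + g.inner x (F x) (bracket ξ F x) = 0 := by
    have j := congr(η x $(bracket_jacobi sξ sE sF x))
    rw [map_add, h.eta_bracket_xi s3 c3, h.eta_bracket s1 sF c1 ηF,
      h.eta_bracket sE s2 ηE c2, h.inner_phi_swap sE s2, hφF, hFx, map_neg,
      g.symm x (bracket ξ E x), g.symm x (bracket ξ F x)] at j
    linarith
  -- This is `hE = E` with the factor `1/2` cleared; its `E`- and `F`-components are `hp` and `hs`.
  have hE' (x : M) : bracket ξ F x - φ x (bracket ξ E x) = (2 : ℝ) • E x := by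
    rw [← hE x, hOp, smul_smul]; norm_num; rfl
  have hp (x : M) : g.inner x (E x) (bracket ξ F x) + g.inner x (F x) (bracket ξ E x) = 2 := by
    have k := congr(g.inner x (E x) $(hE' x))
    rw [map_sub, map_smul, hE_unit, h.inner_phi_swap sE s1, hFx, g.symm x (bracket ξ E x)] at k
    simpa using k
  have hs (x : M) : g.inner x (F x) (bracket ξ F x) - g.inner x (E x) (bracket ξ E x) = 0 := by
    have k := congr(g.inner x (F x) $(hE' x))
    rw [map_sub, map_smul, fr.F_E, h.inner_phi_swap sF s1, hφF, map_neg,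
      g.symm x (bracket ξ E x)] at k
    simpa using k
  have hp0 (x : M) : g.inner x (E x) (bracket ξ E x) = 0 := by linarith [hs x, hjac x]
  have hs0 (x : M) : g.inner x (F x) (bracket ξ F x) = 0 := by linarith [hs x, hjac x]
  simp only [eta_eq] at c1 c2 c3
  obtain ⟨D, hD, hR⟩ := hflat
  have Dξ_E (x : M) : D ξ x (E x) = (-2 : ℝ) • F x := by
    refine fr.ext ?_ ?_ ?_
    · have := hD.koszul_const sE sξ sE fr.xi_E fr.E_E fr.E_xi x
      simp [bracket_self_apply, bracket_swap_apply E ξ, hp0, fr.E_F] at this ⊢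
      linarith
    · have := hD.koszul_const sE sξ sF fr.xi_F fr.E_F fr.E_xi x
      simp [bracket_swap_apply E ξ, c3, fr.F_F] at this ⊢
      linarith [hp x]
    · have := hD.koszul_const sE sξ sξ fr.xi_xi fr.E_xi fr.E_xi x
      simp [bracket_self_apply, bracket_swap_apply E ξ, c1, fr.xi_F] at this ⊢
      linarith
  have Dξ_F (x : M) : D ξ x (F x) = 0 := by
    refine fr.ext ?_ ?_ ?_
    · have := hD.koszul_const sF sξ sE fr.xi_E fr.F_E fr.F_xi x
      simp [bracket_swap_apply F ξ, bracket_swap_apply F E, c3] at this ⊢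
      linarith [hp x]
    · have := hD.koszul_const sF sξ sF fr.xi_F fr.F_F fr.F_xi x
      simp [bracket_self_apply, bracket_swap_apply F ξ, hs0] at this ⊢
      linarith
    · have := hD.koszul_const sF sξ sξ fr.xi_xi fr.F_xi fr.F_xi x
      simp [bracket_self_apply, bracket_swap_apply F ξ, c2] at this ⊢
      linarith
  have Dξ_ξ (x : M) : D ξ x (ξ x) = 0 := by
    refine fr.ext ?_ ?_ ?_
    · have := hD.koszul_const sξ sξ sE fr.xi_E fr.xi_E fr.xi_xi x
      simp [bracket_self_apply, c1] at this ⊢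
      linarith
    · have := hD.koszul_const sξ sξ sF fr.xi_F fr.xi_F fr.xi_xi x
      simp [bracket_self_apply, c2] at this ⊢
      linarith
    · have := hD.koszul_const sξ sξ sξ fr.xi_xi fr.xi_xi fr.xi_xi x
      simp [bracket_self_apply] at this ⊢
      linarith
  have Dξ (x : M) (v : TangentSpace (𝓡 3) x) :
      D ξ x v = (-2 * g.inner x (E x) v) • F x := by
    conv_lhs => rw [fr.eq_sum x v]
    simp [Dξ_E, Dξ_F, Dξ_ξ, smul_smul, mul_comm]
  have D0 (f : VField M) (hf : ∀ x, f x = 0) (x : M) : D f x = 0 := by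
    obtain rfl : f = 0 := funext hf
    rw [CovariantDerivative.zero]; rfl
  have D2 (x : M) : D (fun y => D ξ y (E y)) x = (-2 : ℝ) • D F x := by
    rw [funext Dξ_E]
    exact D.isCovariantDerivativeOn.smul_const (-2 : ℝ) (sF.mdifferentiableAt x)
  -- `R(E, ξ)ξ = 0` reduces to `∇_ξ F = 0`, whose `E`-component says `p + 2 - q = 0`; together with
  -- `p + q = 2` this gives `q = 2`.
  have hq (x : M) : g.inner x (F x) (bracket ξ E x) = 2 := by
    have r := congr(g.inner x (E x) $(hR E ξ ξ sE sξ sξ x))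
    have := hD.koszul_const sξ sF sE fr.F_E fr.xi_E fr.xi_F x
    rw [curvature, D2, D0 _ Dξ_ξ, Dξ, bracket_swap_apply E ξ] at r
    simp [hp0, bracket_swap_apply F E, c3] at r this
    linarith [hp x]
  -- `R(E, F)ξ = 0` reads `∇_F F + g(E, [E, F]) F = 0`. Here `g(E, ∇_F F) = g(F, [E, F])` and `g(F,
  -- ∇_F F) = 0`.
  have hb (x : M) : g.inner x (E x) (bracket E F x) = 0 ∧ g.inner x (F x) (bracket E F x) = 0 := by
    have r := hR E F ξ sE sF sξ x
    have rE := congr(g.inner x (E x) $r)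
    have rF := congr(g.inner x (F x) $r)
    have h1 := hD.koszul_const sF sF sE fr.F_E fr.F_E fr.F_F x
    have h2 := hD.koszul_const sF sF sF fr.F_F fr.F_F fr.F_F x
    rw [curvature, D2, D0 _ Dξ_F, Dξ] at rE rF
    simp [bracket_self_apply, bracket_swap_apply F E, fr.E_F, fr.F_F] at rE rF h1 h2
    constructor <;> linarith
  refine ⟨fr, eta_eq, ?_, ?_, ?_, ?_⟩
  · intro X Y hX hY x
    rw [h.associated X Y hX hY x]
    conv_lhs => rw [fr.eq_sum x (Y x)]
    simp [h.phi_xi, hφF, hFx, g.symm x (X x)]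
    ring
  · intro x
    refine fr.ext ?_ ?_ ?_ <;> simp [fr.E_F, fr.F_F, fr.xi_F, hp0, hq, c1]
  · intro x
    refine fr.ext ?_ ?_ ?_ <;> simp [hs0, c2]
    linarith [hp x, hq x]
  · intro x
    refine fr.ext ?_ ?_ ?_ <;> simp [(hb x).1, (hb x).2, c3, fr.E_xi, fr.F_xi, fr.xi_xi]

end FlatContact

/-! ### Metrics with prescribed matrix in a frame -/

section FrameMetric

variable {M : Type*} [TopologicalSpace M] [ChartedSpace (EuclideanSpace ℝ (Fin 3)) M]

lemma contMDiff_sq_div_two {f : M → ℝ} (hf : ContMDiff (𝓡 3) 𝓘(ℝ) ∞ f) :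
    ContMDiff (𝓡 3) 𝓘(ℝ) ∞ (fun x => f x ^ 2 / 2) := by
  simp only [div_eq_mul_inv]
  exact (hf.pow 2).mul (contMDiff_const (c := (2 : ℝ)⁻¹))

variable [IsManifold (𝓡 3) ∞ M]

namespace Metric.IsOrthonormalFrame

variable {g : Metric M} {ξ E F : VField M} (h : g.IsOrthonormalFrame ξ E F)
include h

lemma inner_eq (x : M) (v w : TangentSpace (𝓡 3) x) :
    g.inner x v w = g.inner x (E x) v * g.inner x (E x) w
      + g.inner x (F x) v * g.inner x (F x) w + g.inner x (ξ x) v * g.inner x (ξ x) w := by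
  conv_lhs => rw [h.eq_sum x v]
  simp

/-- Two bilinear forms with the same values on a frame coincide. -/
lemma bilin_ext {x : M} {b b' : TangentSpace (𝓡 3) x →L[ℝ] TangentSpace (𝓡 3) x →L[ℝ] ℝ}
    (hb : ∀ u ∈ ({E x, F x, ξ x} : Set (TangentSpace (𝓡 3) x)),
      ∀ w ∈ ({E x, F x, ξ x} : Set (TangentSpace (𝓡 3) x)), b u w = b' u w) : b = b' := by
  simp only [Set.mem_insert_iff, Set.mem_singleton_iff, forall_eq_or_imp, forall_eq] at hb
  obtain ⟨⟨h1, h2, h3⟩, ⟨h4, h5, h6⟩, h7, h8, h9⟩ := hb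
  ext v w
  rw [h.eq_sum x v, h.eq_sum x w]
  simp [h1, h2, h3, h4, h5, h6, h7, h8, h9]

end Metric.IsOrthonormalFrame

/-- The form with matrix `(a, c; c, d)` on `E, F`, and for which `ξ` is a unit normal. -/
noncomputable def frameForm (g : Metric M) (ξ E F : VField M) (a c d : M → ℝ) (x : M) :
    TangentSpace (𝓡 3) x →L[ℝ] TangentSpace (𝓡 3) x →L[ℝ] ℝ :=
  (g.inner x (E x)).smulRight (a x • g.inner x (E x) + c x • g.inner x (F x))
    + (g.inner x (F x)).smulRight (c x • g.inner x (E x) + d x • g.inner x (F x))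
    + (g.inner x (ξ x)).smulRight (g.inner x (ξ x))

lemma frameForm_apply (g : Metric M) (ξ E F : VField M) (a c d : M → ℝ) (x : M)
    (v w : TangentSpace (𝓡 3) x) :
    frameForm g ξ E F a c d x v w =
      a x * (g.inner x (E x) v * g.inner x (E x) w)
      + c x * (g.inner x (E x) v * g.inner x (F x) w + g.inner x (F x) v * g.inner x (E x) w)
      + d x * (g.inner x (F x) v * g.inner x (F x) w)
      + g.inner x (ξ x) v * g.inner x (ξ x) w := by
  simp [frameForm]
  ring

lemma OneForm.IsSmooth.add {α β : OneForm M} (hα : α.IsSmooth) (hβ : β.IsSmooth) :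
    OneForm.IsSmooth (fun x => α x + β x) :=
  ContMDiff.add_section hα hβ

lemma OneForm.IsSmooth.smul {f : M → ℝ} {α : OneForm M} (hf : ContMDiff (𝓡 3) 𝓘(ℝ) ∞ f)
    (hα : α.IsSmooth) : OneForm.IsSmooth (fun x => f x • α x) :=
  ContMDiff.smul_section hf hα

lemma contMDiff_frameForm {g : Metric M} {ξ E F : VField M} (h : g.IsOrthonormalFrame ξ E F)
    {a c d : M → ℝ} (ha : ContMDiff (𝓡 3) 𝓘(ℝ) ∞ a) (hc : ContMDiff (𝓡 3) 𝓘(ℝ) ∞ c)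
    (hd : ContMDiff (𝓡 3) 𝓘(ℝ) ∞ d) :
    ContMDiff (𝓡 3)
      ((𝓡 3).prod 𝓘(ℝ, EuclideanSpace ℝ (Fin 3) →L[ℝ] EuclideanSpace ℝ (Fin 3) →L[ℝ] ℝ)) ∞
      (fun x => TotalSpace.mk' (EuclideanSpace ℝ (Fin 3) →L[ℝ] EuclideanSpace ℝ (Fin 3) →L[ℝ] ℝ)
        (E := fun x : M => TangentSpace (𝓡 3) x →L[ℝ] TangentSpace (𝓡 3) x →L[ℝ]
          Bundle.Trivial M ℝ x) x (frameForm g ξ E F a c d x)) := by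
  have hE := g.flat_isSmooth h.smooth_E
  have hF := g.flat_isSmooth h.smooth_F
  have hξ := g.flat_isSmooth h.smooth_xi
  exact ((contMDiff_smulRight hE ((hE.smul ha).add (hF.smul hc))).add_section
    (contMDiff_smulRight hF ((hE.smul hc).add (hF.smul hd)))).add_section
    (contMDiff_smulRight hξ hξ)

/-- By Cayley–Hamilton, `det A = 1` gives `tr A · A = 1 + A²`, hence `tr A · ⟨Av, v⟩ = |v|² + |Av|²`
on the plane of `E`, `F`; the trace is at least `1`, which handles `ξ`. This bound provides both
positivity and boundedness of the unit ball. -/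
lemma inner_self_le_frameForm {g : Metric M} {ξ E F : VField M} (h : g.IsOrthonormalFrame ξ E F)
    {a c d : M → ℝ} (ha : ∀ x, 0 < a x) (hdet : ∀ x, a x * d x - c x ^ 2 = 1) (x : M)
    (v : TangentSpace (𝓡 3) x) :
    g.inner x v v ≤ (a x + d x) * frameForm g ξ E F a c d x v v := by
  have hax := ha x
  have hdx := hdet x
  rw [h.inner_eq, frameForm_apply]
  set p := g.inner x (E x) v
  set q := g.inner x (F x) v
  set r := g.inner x (ξ x) v
  have had : 1 ≤ a x * d x := by nlinarith [sq_nonneg (c x)]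
  have hd0 : 0 < d x := by
    by_contra hneg
    nlinarith
  have hsum : 1 ≤ a x + d x := by nlinarith [sq_nonneg (a x - d x)]
  have key : (a x + d x) * (a x * (p * p) + c x * (p * q + q * p) + d x * (q * q))
      = p * p + q * q + (a x * p + c x * q) ^ 2 + (c x * p + d x * q) ^ 2 := by
    linear_combination (p ^ 2 + q ^ 2) * hdx
  nlinarith [sq_nonneg (a x * p + c x * q), sq_nonneg (c x * p + d x * q), mul_self_nonneg r]

/-- The metric with matrix `(a, c; c, d)` on `E, F`, for which `ξ` is a unit normal. -/
noncomputable def frameMetric {g : Metric M} {ξ E F : VField M} (h : g.IsOrthonormalFrame ξ E F)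
    {a c d : M → ℝ} (ha : ContMDiff (𝓡 3) 𝓘(ℝ) ∞ a) (hc : ContMDiff (𝓡 3) 𝓘(ℝ) ∞ c)
    (hd : ContMDiff (𝓡 3) 𝓘(ℝ) ∞ d) (hapos : ∀ x, 0 < a x)
    (hdet : ∀ x, a x * d x - c x ^ 2 = 1) : Metric M where
  inner := frameForm g ξ E F a c d
  symm x v w := by
    rw [frameForm_apply, frameForm_apply]
    ring
  pos x v hv := by
    have h1 := inner_self_le_frameForm h hapos hdet x v
    have h2 := g.pos x v hv
    have h3 : 0 < a x + d x := by nlinarith [hapos x, hdet x, sq_nonneg (c x)]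
    by_contra hneg
    nlinarith
  isVonNBounded x := by
    have h3 : 0 < a x + d x := by nlinarith [hapos x, hdet x, sq_nonneg (c x)]
    -- The unit ball of the new form lies in `k` times that of `g`.
    set k := √(a x + d x)
    have hk : 0 < k := Real.sqrt_pos.2 h3
    have hk2 : k ^ 2 = a x + d x := Real.sq_sqrt h3.le
    refine ((g.isVonNBounded x).image
      (k • ContinuousLinearMap.id ℝ (TangentSpace (𝓡 3) x))).subset fun v hv => ?_
    refine ⟨k⁻¹ • v, ?_, ?_⟩
    · have h1 := inner_self_le_frameForm h hapos hdet x v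
      simp only [Set.mem_ofPred_eq] at hv ⊢
      simp only [map_smul, smul_apply, smul_eq_mul]
      rw [← mul_assoc, ← mul_inv, ← sq, hk2, inv_mul_lt_iff₀ h3]
      nlinarith
    · simp [smul_smul, hk.ne']
  contMDiff := contMDiff_frameForm h ha hc hd

lemma IsDeformedMetric.inner_eq {g gf : Metric M} {ξ E : VField M} {φ : EndField M} {f : M → ℝ}
    (hgf : IsDeformedMetric ξ φ E f gf) (h : g.IsOrthonormalFrame ξ E (fun x => φ x (E x))) :
    gf.inner = frameForm g ξ E (fun x => φ x (E x)) (fun x => 1 + f x + f x ^ 2 / 2)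
      (fun x => f x ^ 2 / 2) (fun x => 1 - f x + f x ^ 2 / 2) := by
  funext x
  refine h.bilin_ext ?_
  simp [frameForm_apply, h.E_E, h.E_F, h.E_xi, h.F_E, h.F_F, h.F_xi, h.xi_E, h.xi_F, h.xi_xi,
    hgf.E_E, hgf.phiE_phiE, hgf.E_phiE, hgf.xi_E, hgf.xi_phiE, hgf.xi_xi,
    gf.symm x (φ x (E x)) (E x), gf.symm x _ (ξ x)]

theorem existsUnique_isDeformedMetric {g : Metric M} {ξ E : VField M} {φ : EndField M}
    (h : g.IsOrthonormalFrame ξ E (fun x => φ x (E x))) {f : M → ℝ}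
    (hf : ContMDiff (𝓡 3) 𝓘(ℝ) ∞ f) :
    ∃! gf : Metric M, IsDeformedMetric ξ φ E f gf := by
  have hf2 := contMDiff_sq_div_two hf
  refine ⟨frameMetric h (a := fun x => 1 + f x + f x ^ 2 / 2) (c := fun x => f x ^ 2 / 2)
    (d := fun x => 1 - f x + f x ^ 2 / 2) ((contMDiff_const.add hf).add hf2) hf2
    -- Positivity holds because `1 + f + f²/2 = ((f + 1)² + 1)/2`; the determinant is `(1 + f²/2)² -
    -- f² - f⁴/4 = 1`.
    ((contMDiff_const.sub hf).add hf2) (fun x => by nlinarith [sq_nonneg (f x + 1)])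
    (fun x => by ring), ?_, fun gf hgf => ?_⟩
  · constructor <;> intro x <;> simp [frameMetric, frameForm_apply, h.E_E, h.E_F, h.E_xi, h.F_E,
      h.F_F, h.F_xi, h.xi_E, h.xi_F, h.xi_xi]
  · have := hgf.inner_eq h
    cases gf
    subst this
    rfl

end FrameMetric

/-! ### Deformed contact metric structures -/

section Deformation

variable {M : Type*} [TopologicalSpace M] [ChartedSpace (EuclideanSpace ℝ (Fin 3)) M]

lemma mvfderiv_mul_add_mul {u v p q : M → ℝ} (hu : ContMDiff (𝓡 3) 𝓘(ℝ) ∞ u)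
    (hv : ContMDiff (𝓡 3) 𝓘(ℝ) ∞ v) (hp : ContMDiff (𝓡 3) 𝓘(ℝ) ∞ p)
    (hq : ContMDiff (𝓡 3) 𝓘(ℝ) ∞ q) {x : M} {w : TangentSpace (𝓡 3) x}
    (hu0 : mvfderiv (𝓡 3) u x w = 0) (hv0 : mvfderiv (𝓡 3) v x w = 0) :
    mvfderiv (𝓡 3) (fun y => u y * p y + v y * q y) x w =
      u x * mvfderiv (𝓡 3) p x w + v x * mvfderiv (𝓡 3) q x w := by
  have du := hu.mdifferentiable (by simp) x
  have dv := hv.mdifferentiable (by simp) x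
  have dp := hp.mdifferentiable (by simp) x
  have dq := hq.mdifferentiable (by simp) x
  have dup : MDifferentiableAt (𝓡 3) 𝓘(ℝ) (fun y => u y * p y) x := du.mul dp
  have dvq : MDifferentiableAt (𝓡 3) 𝓘(ℝ) (fun y => v y * q y) x := dv.mul dq
  rw [mvfderiv_fun_add dup dvq, mvfderiv_fun_mul du dp, mvfderiv_fun_mul dv dq]
  simp [hu0, hv0]

lemma mvfderiv_add_apply_eq_zero {u v : M → ℝ} (hu : ContMDiff (𝓡 3) 𝓘(ℝ) ∞ u)
    (hv : ContMDiff (𝓡 3) 𝓘(ℝ) ∞ v) {x : M} {w : TangentSpace (𝓡 3) x}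
    (hu0 : mvfderiv (𝓡 3) u x w = 0) (hv0 : mvfderiv (𝓡 3) v x w = 0) :
    mvfderiv (𝓡 3) (fun y => u y + v y) x w = 0 := by
  rw [mvfderiv_fun_add (hu.mdifferentiable (by simp) x) (hv.mdifferentiable (by simp) x)]
  simp [hu0, hv0]

lemma mvfderiv_sub_apply_eq_zero {u v : M → ℝ} (hu : ContMDiff (𝓡 3) 𝓘(ℝ) ∞ u)
    (hv : ContMDiff (𝓡 3) 𝓘(ℝ) ∞ v) {x : M} {w : TangentSpace (𝓡 3) x}
    (hu0 : mvfderiv (𝓡 3) u x w = 0) (hv0 : mvfderiv (𝓡 3) v x w = 0) :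
    mvfderiv (𝓡 3) (fun y => u y - v y) x w = 0 := by
  rw [mvfderiv_fun_sub (hu.mdifferentiable (by simp) x) (hv.mdifferentiable (by simp) x)]
  simp [hu0, hv0]

lemma mvfderiv_mul_apply_eq_zero {u v : M → ℝ} (hu : ContMDiff (𝓡 3) 𝓘(ℝ) ∞ u)
    (hv : ContMDiff (𝓡 3) 𝓘(ℝ) ∞ v) {x : M} {w : TangentSpace (𝓡 3) x}
    (hu0 : mvfderiv (𝓡 3) u x w = 0) (hv0 : mvfderiv (𝓡 3) v x w = 0) :
    mvfderiv (𝓡 3) (fun y => u y * v y) x w = 0 := by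
  rw [mvfderiv_fun_mul (hu.mdifferentiable (by simp) x) (hv.mdifferentiable (by simp) x)]
  simp [hu0, hv0]

lemma mvfderiv_const_apply_eq_zero (k : ℝ) (x : M) (w : TangentSpace (𝓡 3) x) :
    mvfderiv (𝓡 3) (fun _ : M => k) x w = 0 :=
  mvfderiv_eq_zero_of_forall_eq (fun _ => rfl) x w

lemma mvfderiv_neg_apply_eq_zero {u : M → ℝ} {x : M} {w : TangentSpace (𝓡 3) x}
    (hu : mvfderiv (𝓡 3) u x w = 0) : mvfderiv (𝓡 3) (fun y => -u y) x w = 0 := by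
  rw [mvfderiv_fun_neg]
  simp [hu]

variable [IsManifold (𝓡 3) ∞ M]

/-- The endomorphism field `φ` with `dη = 2 G(·, φ ·)` for `G = frameForm g ξ E F a c d`. -/
noncomputable def frameEnd (g : Metric M) (E F : VField M) (a c d : M → ℝ) : EndField M :=
  fun x => (g.inner x (E x)).smulRight (a x • F x + -c x • E x)
    + (g.inner x (F x)).smulRight (c x • F x + -d x • E x)

lemma EndField.IsSmooth.add {A B : EndField M} (hA : A.IsSmooth) (hB : B.IsSmooth) :
    EndField.IsSmooth (fun x => A x + B x) :=
  ContMDiff.add_section hA hB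

lemma frameEnd_isSmooth {g : Metric M} {ξ E F : VField M} (h : g.IsOrthonormalFrame ξ E F)
    {a c d : M → ℝ} (ha : ContMDiff (𝓡 3) 𝓘(ℝ) ∞ a) (hc : ContMDiff (𝓡 3) 𝓘(ℝ) ∞ c)
    (hd : ContMDiff (𝓡 3) 𝓘(ℝ) ∞ d) : (frameEnd g E F a c d).IsSmooth := by
  have hE := g.flat_isSmooth h.smooth_E
  have hF := g.flat_isSmooth h.smooth_F
  exact EndField.IsSmooth.add
    (contMDiff_smulRight hE ((h.smooth_F.smul ha).add (h.smooth_E.smul hc.neg)))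
    (contMDiff_smulRight hF ((h.smooth_F.smul hc).add (h.smooth_E.smul hd.neg)))

/-- Constant coefficients in the global frame suffice. This turns identities stated for smooth
vector fields into identities at a point. -/
lemma Metric.IsOrthonormalFrame.exists_smooth_extension {g : Metric M} {ξ E F : VField M}
    (h : g.IsOrthonormalFrame ξ E F) (x : M) (v : TangentSpace (𝓡 3) x) :
    ∃ X : VField M, X.IsSmooth ∧ X x = v :=
  ⟨(fun _ => g.inner x (E x) v) • E + (fun _ => g.inner x (F x) v) • F
      + (fun _ => g.inner x (ξ x) v) • ξ,
    ((h.smooth_E.smul contMDiff_const).add (h.smooth_F.smul contMDiff_const)).add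
      (h.smooth_xi.smul contMDiff_const), (h.eq_sum x v).symm⟩

/-- A metric `G` with matrix `(a, c; c, d)` of determinant `1`, invariant along `ξ`, with respect
to the frame `E, F` of a flat contact metric structure, and with unit normal `ξ`. -/
structure IsFrameDeformation (η : OneForm M) (g : Metric M) (ξ E F : VField M) (a c d : M → ℝ)
    (G : Metric M) : Prop extends IsFlatContactFrame η g ξ E F where
  smooth_a : ContMDiff (𝓡 3) 𝓘(ℝ) ∞ a
  smooth_c : ContMDiff (𝓡 3) 𝓘(ℝ) ∞ c
  smooth_d : ContMDiff (𝓡 3) 𝓘(ℝ) ∞ d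
  det : ∀ x, a x * d x - c x ^ 2 = 1
  xi_a : ∀ x, mvfderiv (𝓡 3) a x (ξ x) = 0
  xi_c : ∀ x, mvfderiv (𝓡 3) c x (ξ x) = 0
  xi_d : ∀ x, mvfderiv (𝓡 3) d x (ξ x) = 0
  inner_eq : G.inner = frameForm g ξ E F a c d

namespace IsFlatContactFrame

variable {η : OneForm M} {g : Metric M} {ξ E F : VField M} (h : IsFlatContactFrame η g ξ E F)
include h

/-- On frame components, bracketing with `ξ` is differentiation along `ξ` plus the constant
nilpotent matrix `E ↦ 2F`, `F ↦ 0`, `ξ ↦ 0`. -/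
lemma bracket_xi {X : VField M} (hX : X.IsSmooth) (x : M) :
    bracket ξ X x = mvfderiv (𝓡 3) (fun y => g.inner y (E y) (X y)) x (ξ x) • E x
      + (2 * g.inner x (E x) (X x) + mvfderiv (𝓡 3) (fun y => g.inner y (F y) (X y)) x (ξ x)) • F x
      + mvfderiv (𝓡 3) (fun y => g.inner y (ξ y) (X y)) x (ξ x) • ξ x := by
  have h1 := g.inner_contMDiff h.smooth_E hX
  have h2 := g.inner_contMDiff h.smooth_F hX
  have h3 := g.inner_contMDiff h.smooth_xi hX
  have hX' : X = (fun y => g.inner y (E y) (X y)) • E + (fun y => g.inner y (F y) (X y)) • F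
      + (fun y => g.inner y (ξ y) (X y)) • ξ := funext fun y => h.eq_sum y (X y)
  have d1 := (h1.mdifferentiable (by simp)) x
  have d2 := (h2.mdifferentiable (by simp)) x
  have d3 := (h3.mdifferentiable (by simp)) x
  have sE := h.smooth_E.smul h1
  have sF := h.smooth_F.smul h2
  have sξ := h.smooth_xi.smul h3
  have e1 := h.bracket_xi_E x
  have e2 := h.bracket_xi_F x
  have e3 := bracket_self_apply ξ x
  conv_lhs => rw [hX']
  rw [bracket] at e1 e2 e3 ⊢
  rw [VectorField.mlieBracket_add_right ((sE.add sF).mdifferentiableAt x) (sξ.mdifferentiableAt x),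
    VectorField.mlieBracket_add_right (sE.mdifferentiableAt x) (sF.mdifferentiableAt x),
    VectorField.mlieBracket_smul_right d1 (h.smooth_E.mdifferentiableAt x),
    VectorField.mlieBracket_smul_right d2 (h.smooth_F.mdifferentiableAt x),
    VectorField.mlieBracket_smul_right d3 (h.smooth_xi.mdifferentiableAt x), e1, e2, e3]
  module

lemma inner_E_bracket_xi {X : VField M} (hX : X.IsSmooth) (x : M) :
    g.inner x (E x) (bracket ξ X x) =
      mvfderiv (𝓡 3) (fun y => g.inner y (E y) (X y)) x (ξ x) := by
  simp [h.bracket_xi hX, h.E_E, h.E_F, h.E_xi]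

lemma inner_F_bracket_xi {X : VField M} (hX : X.IsSmooth) (x : M) :
    g.inner x (F x) (bracket ξ X x) = 2 * g.inner x (E x) (X x) +
      mvfderiv (𝓡 3) (fun y => g.inner y (F y) (X y)) x (ξ x) := by
  simp [h.bracket_xi hX, h.F_E, h.F_F, h.F_xi]

lemma inner_xi_bracket_xi {X : VField M} (hX : X.IsSmooth) (x : M) :
    g.inner x (ξ x) (bracket ξ X x) =
      mvfderiv (𝓡 3) (fun y => g.inner y (ξ y) (X y)) x (ξ x) := by
  simp [h.bracket_xi hX, h.xi_E, h.xi_F, h.xi_xi]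

end IsFlatContactFrame

namespace IsFrameDeformation

variable {η : OneForm M} {g : Metric M} {ξ E F : VField M} {a c d : M → ℝ} {G : Metric M}
  (h : IsFrameDeformation η g ξ E F a c d G)
include h

lemma G_apply (x : M) (v w : TangentSpace (𝓡 3) x) :
    G.inner x v w = a x * (g.inner x (E x) v * g.inner x (E x) w)
      + c x * (g.inner x (E x) v * g.inner x (F x) w + g.inner x (F x) v * g.inner x (E x) w)
      + d x * (g.inner x (F x) v * g.inner x (F x) w)
      + g.inner x (ξ x) v * g.inner x (ξ x) w := by
  rw [h.inner_eq, frameForm_apply]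

lemma inner_E_frameEnd (x : M) (v : TangentSpace (𝓡 3) x) :
    g.inner x (E x) (frameEnd g E F a c d x v) =
      -c x * g.inner x (E x) v + -d x * g.inner x (F x) v := by
  simp [frameEnd, h.E_E, h.E_F]; ring

lemma inner_F_frameEnd (x : M) (v : TangentSpace (𝓡 3) x) :
    g.inner x (F x) (frameEnd g E F a c d x v) =
      a x * g.inner x (E x) v + c x * g.inner x (F x) v := by
  simp [frameEnd, h.F_E, h.F_F]; ring

lemma inner_xi_frameEnd (x : M) (v : TangentSpace (𝓡 3) x) :
    g.inner x (ξ x) (frameEnd g E F a c d x v) = 0 := by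
  simp [frameEnd, h.xi_E, h.xi_F]

/-- On the plane of `E`, `F` this is `AJA = det A · J` with `det A = 1`. -/
lemma isAssociated : IsAssociated η (frameEnd g E F a c d) G := by
  intro X Y hX hY x
  rw [h.dForm_eq X Y hX hY, h.G_apply, h.inner_E_frameEnd, h.inner_F_frameEnd,
    h.inner_xi_frameEnd]
  linear_combination -2 * (g.inner x (F x) (X x) * g.inner x (E x) (Y x)
      - g.inner x (E x) (X x) * g.inner x (F x) (Y x)) * h.det x

lemma eq_frameEnd {φ : EndField M} (hφ : IsAssociated η φ G) : φ = frameEnd g E F a c d := by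
  funext x
  ext1 v
  refine G.eq_of_inner_eq fun u => ?_
  obtain ⟨X, hX, rfl⟩ := h.exists_smooth_extension x u
  obtain ⟨Y, hY, rfl⟩ := h.exists_smooth_extension x v
  have h1 := hφ X Y hX hY x
  rw [h.isAssociated X Y hX hY x] at h1
  rw [G.symm x _ (X x), G.symm x _ (X x)]
  linarith

theorem isContactMetric (hη : IsContactForm η) :
    IsContactMetric η ξ (frameEnd g E F a c d) G where
  contact := hη
  smooth_xi := h.smooth_xi
  smooth_phi := frameEnd_isSmooth h.toIsOrthonormalFrame h.smooth_a h.smooth_c h.smooth_d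
  unit_xi x := by simp [h.G_apply, h.E_xi, h.F_xi, h.xi_xi]
  eta_xi x := by rw [h.eta_eq, h.xi_xi]
  phi_sq x v := by
    refine h.ext ?_ ?_ ?_ <;>
    simp only [h.inner_E_frameEnd, h.inner_F_frameEnd, h.inner_xi_frameEnd, map_add, map_neg,
      map_smul, h.E_xi, h.F_xi, h.xi_xi, h.eta_eq, smul_eq_mul]
    · linear_combination -g.inner x (E x) v * h.det x
    · linear_combination -g.inner x (F x) v * h.det x
    · ring
  phi_xi x := by
    refine h.ext ?_ ?_ ?_ <;>
    simp [h.inner_E_frameEnd, h.inner_F_frameEnd, h.inner_xi_frameEnd, h.E_xi, h.F_xi]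
  associated := h.isAssociated

/-- The derivatives of the components of `X` cancel and those of `a`, `c`, `d` vanish, so `h` is
half the commutator of the nilpotent matrix of `ξ`-brackets with `JA`. In particular `h² = d²` on
the plane of `E`, `F`. -/
lemma hOp_eq {X : VField M} (hX : X.IsSmooth) (x : M) :
    hOp ξ (frameEnd g E F a c d) X x = (d x * g.inner x (E x) (X x)) • E x
      + (-2 * c x * g.inner x (E x) (X x) - d x * g.inner x (F x) (X x)) • F x := by
  have s1 := g.inner_contMDiff h.smooth_E hX
  have s2 := g.inner_contMDiff h.smooth_F hX
  have sφ := (frameEnd_isSmooth h.toIsOrthonormalFrame h.smooth_a h.smooth_c h.smooth_d).apply hX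
  have hc := mvfderiv_neg_apply_eq_zero (h.xi_c x)
  have hd := mvfderiv_neg_apply_eq_zero (h.xi_d x)
  refine h.ext ?_ ?_ ?_
  · simp only [hOp, map_smul, map_sub, map_add, h.inner_E_bracket_xi sφ, h.inner_E_frameEnd,
      h.inner_E_bracket_xi hX, h.inner_F_bracket_xi hX, smul_eq_mul, h.E_E, h.E_F,
      mvfderiv_mul_add_mul h.smooth_c.neg h.smooth_d.neg s1 s2 hc hd]
    ring
  · simp only [hOp, map_smul, map_sub, map_add, h.inner_F_bracket_xi sφ, h.inner_F_frameEnd,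
      h.inner_E_frameEnd, h.inner_E_bracket_xi hX, h.inner_F_bracket_xi hX, smul_eq_mul, h.F_E,
      h.F_F, mvfderiv_mul_add_mul h.smooth_a h.smooth_c s1 s2 (h.xi_a x) (h.xi_c x)]
    ring
  · simp [hOp, h.inner_xi_bracket_xi sφ, h.inner_xi_frameEnd, h.xi_E, h.xi_F,
      mvfderiv_const_apply_eq_zero]

lemma ext_G {x : M} {v w : TangentSpace (𝓡 3) x} (hE : G.inner x (E x) v = G.inner x (E x) w)
    (hF : G.inner x (F x) v = G.inner x (F x) w)
    (hxi : G.inner x (ξ x) v = G.inner x (ξ x) w) : v = w := by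
  refine G.eq_of_inner_eq fun u => ?_
  rw [G.symm x v, G.symm x w, h.eq_sum x u]
  simp [hE, hF, hxi]

end IsFrameDeformation

end Deformation

/-! ### The curvature of the deformed metric -/

section Curvature

variable {M : Type*} [TopologicalSpace M] [ChartedSpace (EuclideanSpace ℝ (Fin 3)) M]
  [IsManifold (𝓡 3) ∞ M]

namespace IsFrameDeformation

variable {η : OneForm M} {g : Metric M} {ξ E F : VField M} {a c d : M → ℝ} {G : Metric M}
  (h : IsFrameDeformation η g ξ E F a c d G)
include h

lemma G_xi (x : M) (v : TangentSpace (𝓡 3) x) : G.inner x (ξ x) v = g.inner x (ξ x) v := by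
  simp [h.G_apply, h.E_xi, h.F_xi, h.xi_xi]

lemma G_E (x : M) (v : TangentSpace (𝓡 3) x) :
    G.inner x (E x) v = a x * g.inner x (E x) v + c x * g.inner x (F x) v := by
  simp [h.G_apply, h.E_E, h.F_E, h.xi_E]

lemma G_F (x : M) (v : TangentSpace (𝓡 3) x) :
    G.inner x (F x) v = c x * g.inner x (E x) v + d x * g.inner x (F x) v := by
  simp [h.G_apply, h.E_F, h.F_F, h.xi_F]

/-- Pairings with `ξ` are constant and the remaining pairing is constant along `ξ`, so only the
bracket terms of the Koszul formula survive. -/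
lemma koszul_xi {nabla : Connection M} (hLC : IsLeviCivita G nabla) {X Z : VField M}
    (hX : X.IsSmooth) (hZ : Z.IsSmooth) {p q : ℝ} (hXξ : ∀ x, G.inner x (X x) (ξ x) = p)
    (hξZ : ∀ x, G.inner x (ξ x) (Z x) = q) (x : M)
    (hXZ : mvfderiv (𝓡 3) (fun y => G.inner y (X y) (Z y)) x (ξ x) = 0) :
    2 * G.inner x (Z x) (nabla ξ x (X x)) =
      -G.inner x (Z x) (bracket ξ X x) - G.inner x (X x) (bracket ξ Z x)
        - g.inner x (ξ x) (bracket X Z x) := by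
  rw [G.symm, hLC.koszul hX h.smooth_xi hZ, mvfderiv_eq_zero_of_forall_eq hXξ,
    mvfderiv_eq_zero_of_forall_eq hξZ, hXZ, bracket_swap_apply X ξ, G.symm x _ (Z x),
    G.symm x _ (X x), G.symm x _ (ξ x), h.G_xi, map_neg]
  ring

lemma G_E_xi (x : M) : G.inner x (E x) (ξ x) = 0 := by simp [h.G_E, h.E_xi, h.F_xi]

lemma G_F_xi (x : M) : G.inner x (F x) (ξ x) = 0 := by simp [h.G_F, h.E_xi, h.F_xi]

lemma G_xi_E (x : M) : G.inner x (ξ x) (E x) = 0 := by simp [h.G_xi, h.xi_E]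

lemma G_xi_F (x : M) : G.inner x (ξ x) (F x) = 0 := by simp [h.G_xi, h.xi_F]

lemma G_xi_xi (x : M) : G.inner x (ξ x) (ξ x) = 1 := by simp [h.G_xi, h.xi_xi]

lemma nabla_xi_E {nabla : Connection M} (hLC : IsLeviCivita G nabla) (x : M) :
    nabla ξ x (E x) = (c x * (1 - d x)) • E x + (2 * c x ^ 2 - a x * (d x + 1)) • F x := by
  have e1 := h.koszul_xi hLC h.smooth_E h.smooth_E h.G_E_xi h.G_xi_E x
    (by simpa [h.G_E, h.E_E, h.F_E] using h.xi_a x)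
  have e2 := h.koszul_xi hLC h.smooth_E h.smooth_F h.G_E_xi h.G_xi_F x
    (by simpa [h.G_E, h.E_F, h.F_F] using h.xi_c x)
  have e3 := h.koszul_xi hLC h.smooth_E h.smooth_xi h.G_E_xi h.G_xi_xi x
    (mvfderiv_eq_zero_of_forall_eq h.G_E_xi x _)
  refine h.ext_G ?_ ?_ ?_
  · simp [h.G_E, h.E_E, h.E_F, h.F_E, h.F_F, h.bracket_xi_E, bracket_self_apply] at e1 ⊢
    linear_combination e1 / 2 + 2 * c x * h.det x
  · simp [h.G_F, h.E_E, h.E_F, h.F_E, h.F_F, h.bracket_xi_E, h.bracket_xi_F, h.bracket_E_F,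
      h.xi_xi] at e2 ⊢
    linear_combination e2 / 2 + (d x + 1) * h.det x
  · simp [h.G_xi, h.xi_E, h.xi_F, h.bracket_xi_E, bracket_swap_apply E ξ,
      bracket_self_apply] at e3 ⊢
    exact e3

lemma nabla_xi_F {nabla : Connection M} (hLC : IsLeviCivita G nabla) (x : M) :
    nabla ξ x (F x) = (d x * (1 - d x)) • E x + (-c x * (1 - d x)) • F x := by
  have e1 := h.koszul_xi hLC h.smooth_F h.smooth_E h.G_F_xi h.G_xi_E x
    (by simpa [h.G_F, h.E_E, h.F_E] using h.xi_c x)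
  have e2 := h.koszul_xi hLC h.smooth_F h.smooth_F h.G_F_xi h.G_xi_F x
    (by simpa [h.G_F, h.E_F, h.F_F] using h.xi_d x)
  have e3 := h.koszul_xi hLC h.smooth_F h.smooth_xi h.G_F_xi h.G_xi_xi x
    (mvfderiv_eq_zero_of_forall_eq h.G_F_xi x _)
  refine h.ext_G ?_ ?_ ?_
  · simp [h.G_E, h.G_F, h.E_E, h.E_F, h.F_E, h.F_F, h.bracket_xi_E, h.bracket_xi_F,
      bracket_swap_apply F E, h.bracket_E_F, h.xi_xi] at e1 ⊢
    linear_combination e1 / 2 - (1 - d x) * h.det x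
  · simp [h.G_F, h.E_E, h.E_F, h.F_E, h.F_F, h.bracket_xi_F, bracket_self_apply] at e2 ⊢
    linear_combination e2
  · simp [h.G_xi, h.xi_E, h.xi_F, h.bracket_xi_F, bracket_swap_apply F ξ,
      bracket_self_apply] at e3 ⊢
    exact e3

lemma nabla_xi_xi {nabla : Connection M} (hLC : IsLeviCivita G nabla) (x : M) :
    nabla ξ x (ξ x) = 0 := by
  have e1 := h.koszul_xi hLC h.smooth_xi h.smooth_E h.G_xi_xi h.G_xi_E x
    (mvfderiv_eq_zero_of_forall_eq h.G_xi_E x _)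
  have e2 := h.koszul_xi hLC h.smooth_xi h.smooth_F h.G_xi_xi h.G_xi_F x
    (mvfderiv_eq_zero_of_forall_eq h.G_xi_F x _)
  have e3 := h.koszul_xi hLC h.smooth_xi h.smooth_xi h.G_xi_xi h.G_xi_xi x
    (mvfderiv_eq_zero_of_forall_eq h.G_xi_xi x _)
  refine h.ext_G ?_ ?_ ?_
  · simpa [bracket_self_apply, h.bracket_xi_E, h.G_xi, h.xi_F] using e1
  · simpa [bracket_self_apply, h.bracket_xi_F] using e2
  · simpa [bracket_self_apply] using e3

/-- The coefficients are those of `∇ξ = -φ - φh` for the deformed `φ` and `h`. -/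
lemma nabla_xi {nabla : Connection M} (hLC : IsLeviCivita G nabla) (x : M)
    (v : TangentSpace (𝓡 3) x) :
    nabla ξ x v =
      (c x * (1 - d x) * g.inner x (E x) v + d x * (1 - d x) * g.inner x (F x) v) • E x
      + ((2 * c x ^ 2 - a x * (d x + 1)) * g.inner x (E x) v
        + -c x * (1 - d x) * g.inner x (F x) v) • F x := by
  conv_lhs => rw [h.eq_sum x v]
  simp only [map_add, map_smul, h.nabla_xi_E hLC, h.nabla_xi_F hLC, h.nabla_xi_xi hLC]
  module

/-- With `T = ∇ξ` and `B = TX`, absence of torsion gives `∇_ξ B = TB + [ξ, B]`, so `R(X, ξ)ξ = -T²X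
- [ξ, TX] + T[ξ, X]`. The derivatives of the components of `X` cancel, and `ad - c² = 1` makes the
answer depend on the metric only through `d` and `h`. -/
theorem curvature_xi {nabla : Connection M} (hLC : IsLeviCivita G nabla) {X : VField M}
    (hX : X.IsSmooth) (x : M) :
    curvature nabla X ξ ξ x =
      ((1 - d x) * (1 + d x)) • (X x - η x (X x) • ξ x)
        + (2 * (1 - d x)) • hOp ξ (frameEnd g E F a c d) X x := by
  have sX1 := g.inner_contMDiff h.smooth_E hX
  have sX2 := g.inner_contMDiff h.smooth_F hX
  have ha := h.smooth_a
  have hc := h.smooth_c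
  have hd := h.smooth_d
  have xa := h.xi_a x
  have xc := h.xi_c x
  have xd := h.xi_d x
  -- The coefficients of `∇ξ` in the frame.
  have s11 : ContMDiff (𝓡 3) 𝓘(ℝ) ∞ (fun y => c y * (1 - d y)) := hc.mul (contMDiff_const.sub hd)
  have s12 : ContMDiff (𝓡 3) 𝓘(ℝ) ∞ (fun y => d y * (1 - d y)) := hd.mul (contMDiff_const.sub hd)
  have s21 : ContMDiff (𝓡 3) 𝓘(ℝ) ∞ (fun y => 2 * c y ^ 2 - a y * (d y + 1)) :=
    (contMDiff_const.mul (hc.pow 2)).sub (ha.mul (hd.add contMDiff_const))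
  have s22 : ContMDiff (𝓡 3) 𝓘(ℝ) ∞ (fun y => -c y * (1 - d y)) :=
    hc.neg.mul (contMDiff_const.sub hd)
  have s1d : ContMDiff (𝓡 3) 𝓘(ℝ) ∞ (fun y => 1 - d y) := contMDiff_const.sub hd
  have z1d := mvfderiv_sub_apply_eq_zero contMDiff_const hd
    (mvfderiv_const_apply_eq_zero 1 x (ξ x)) xd
  have z11 := mvfderiv_mul_apply_eq_zero hc s1d xc z1d
  have z12 := mvfderiv_mul_apply_eq_zero hd s1d xd z1d
  have z22 := mvfderiv_mul_apply_eq_zero hc.neg s1d (mvfderiv_neg_apply_eq_zero xc) z1d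
  have z21 : mvfderiv (𝓡 3) (fun y => 2 * c y ^ 2 - a y * (d y + 1)) x (ξ x) = 0 := by
    simp only [pow_two]
    exact mvfderiv_sub_apply_eq_zero (contMDiff_const.mul (hc.mul hc))
      (ha.mul (hd.add contMDiff_const))
      (mvfderiv_mul_apply_eq_zero contMDiff_const (hc.mul hc)
        (mvfderiv_const_apply_eq_zero 2 x (ξ x)) (mvfderiv_mul_apply_eq_zero hc hc xc xc))
      (mvfderiv_mul_apply_eq_zero ha (hd.add contMDiff_const) xa
        (mvfderiv_add_apply_eq_zero hd contMDiff_const xd (mvfderiv_const_apply_eq_zero 1 x _)))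
  set B : VField M := fun y => nabla ξ y (X y) with hB
  have hB' : B = (fun y => c y * (1 - d y) * g.inner y (E y) (X y)
        + d y * (1 - d y) * g.inner y (F y) (X y)) • E
      + (fun y => (2 * c y ^ 2 - a y * (d y + 1)) * g.inner y (E y) (X y)
        + -c y * (1 - d y) * g.inner y (F y) (X y)) • F :=
    funext fun y => h.nabla_xi hLC y (X y)
  have sB : B.IsSmooth := by
    rw [hB']
    exact (h.smooth_E.smul ((s11.mul sX1).add (s12.mul sX2))).add
      (h.smooth_F.smul ((s21.mul sX1).add (s22.mul sX2)))
  have BE (y : M) : g.inner y (E y) (B y) = c y * (1 - d y) * g.inner y (E y) (X y)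
        + d y * (1 - d y) * g.inner y (F y) (X y) := by
    simp [hB', h.E_E, h.E_F]
  have BF (y : M) : g.inner y (F y) (B y) = (2 * c y ^ 2 - a y * (d y + 1)) * g.inner y (E y) (X y)
        + -c y * (1 - d y) * g.inner y (F y) (X y) := by
    simp [hB', h.F_E, h.F_F]
  have Bξ (y : M) : g.inner y (ξ y) (B y) = 0 := by
    simp [hB', h.xi_E, h.xi_F]
  have h0 : nabla (fun y => nabla ξ y (ξ y)) x = 0 := by
    have : (fun y => nabla ξ y (ξ y)) = (0 : VField M) := funext (h.nabla_xi_xi hLC)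
    rw [this, CovariantDerivative.zero]; rfl
  have hdet := h.det x
  rw [curvature, h0, hLC.apply_eq h.smooth_xi sB, bracket_swap_apply X ξ, map_neg]
  refine h.ext ?_ ?_ ?_
  · simp only [map_add, map_sub, map_neg, map_smul, h.nabla_xi hLC, h.hOp_eq hX, smul_eq_mul,
      h.inner_E_bracket_xi hX, h.inner_F_bracket_xi hX, h.inner_E_bracket_xi sB, h.E_E, h.E_F,
      h.E_xi, BE, BF, mvfderiv_mul_add_mul s11 s12 sX1 sX2 z11 z12, zero_apply, map_zero]
    linear_combination (1 - d x) * (1 + d x) * g.inner x (E x) (X x) * hdet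
  · simp only [map_add, map_sub, map_neg, map_smul, h.nabla_xi hLC, h.hOp_eq hX, smul_eq_mul,
      h.inner_E_bracket_xi hX, h.inner_F_bracket_xi hX, h.inner_F_bracket_xi sB, h.F_E, h.F_F,
      h.F_xi, BE, BF, mvfderiv_mul_add_mul s21 s22 sX1 sX2 z21 z22, zero_apply, map_zero]
    linear_combination (1 - d x) * (1 + d x) * g.inner x (F x) (X x) * hdet
  · simp [h.nabla_xi hLC, h.hOp_eq hX, h.inner_xi_bracket_xi sB, Bξ, h.xi_E, h.xi_F, h.xi_xi,
      h.eta_eq, mvfderiv_const_apply_eq_zero]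

end IsFrameDeformation

theorem IsDeformedMetric.isFrameDeformation {η : OneForm M} {g gf : Metric M} {ξ E : VField M}
    {φ : EndField M} {f : M → ℝ} (hgf : IsDeformedMetric ξ φ E f gf)
    (h : IsFlatContactFrame η g ξ E (fun x => φ x (E x))) (hf : ContMDiff (𝓡 3) 𝓘(ℝ) ∞ f)
    (hf_xi : ∀ x, mvfderiv (𝓡 3) f x (ξ x) = 0) :
    IsFrameDeformation η g ξ E (fun x => φ x (E x)) (fun x => 1 + f x + f x ^ 2 / 2)
      (fun x => f x ^ 2 / 2) (fun x => 1 - f x + f x ^ 2 / 2) gf := by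
  have hf2 := contMDiff_sq_div_two hf
  have hk : ContMDiff (𝓡 3) 𝓘(ℝ) ∞ (fun _ : M => (1 : ℝ)) := contMDiff_const
  have hk0 (x : M) := mvfderiv_const_apply_eq_zero 1 x (ξ x)
  have hf2_xi (x : M) : mvfderiv (𝓡 3) (fun y => f y ^ 2 / 2) x (ξ x) = 0 := by
    simp only [pow_two, div_eq_mul_inv]
    exact mvfderiv_mul_apply_eq_zero (hf.mul hf) contMDiff_const
      (mvfderiv_mul_apply_eq_zero hf hf (hf_xi x) (hf_xi x)) (mvfderiv_const_apply_eq_zero _ x _)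
  exact
    { h with
      smooth_a := (hk.add hf).add hf2
      smooth_c := hf2
      smooth_d := (hk.sub hf).add hf2
      det := fun x => by ring
      xi_a := fun x => mvfderiv_add_apply_eq_zero (hk.add hf) hf2
        (mvfderiv_add_apply_eq_zero hk hf (hk0 x) (hf_xi x)) (hf2_xi x)
      xi_c := hf2_xi
      xi_d := fun x => mvfderiv_add_apply_eq_zero (hk.sub hf) hf2
        (mvfderiv_sub_apply_eq_zero hk hf (hk0 x) (hf_xi x)) (hf2_xi x)
      inner_eq := hgf.inner_eq h.toIsOrthonormalFrame }

end Curvature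

end ContactThree

/-! ### The proposition -/

theorem mainTheorem9 {M : Type*} [TopologicalSpace M]
    [ChartedSpace (EuclideanSpace ℝ (Fin 3)) M] [IsManifold (𝓡 3) ∞ M]
    [T2Space M] [CompactSpace M]
    (η : ContactThree.OneForm M) (ξ : ContactThree.VField M) (φ : ContactThree.EndField M)
    (g : ContactThree.Metric M)
    (hcontact : ContactThree.IsContactMetric η ξ φ g)
    (hflat : ContactThree.IsFlat g)
    (E : ContactThree.VField M) (hE_smooth : E.IsSmooth)
    (hE_unit : ∀ x, g.inner x (E x) (E x) = 1)
    (hE : ∀ x, ContactThree.hOp ξ φ E x = E x)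
    (f : M → ℝ) (hf : ContMDiff (𝓡 3) 𝓘(ℝ) ∞ f)
    (hf_xi : ∀ x, mvfderiv (𝓡 3) f x (ξ x) = 0)
    (hf_phiE : ∀ x, mvfderiv (𝓡 3) f x (φ x (E x)) = 0) :
    (∃! gf : ContactThree.Metric M, ContactThree.IsDeformedMetric ξ φ E f gf) ∧
    ∀ gf : ContactThree.Metric M, ContactThree.IsDeformedMetric ξ φ E f gf →
      (∃! φf : ContactThree.EndField M, ContactThree.IsAssociated η φf gf) ∧
      ∀ φf : ContactThree.EndField M, ContactThree.IsAssociated η φf gf →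
        ContactThree.IsGeneralizedJacobi η ξ φf gf
          (fun x => (f x - f x ^ 2 / 2) * (2 - f x + f x ^ 2 / 2))
          (fun x => 2 * (f x - f x ^ 2 / 2)) := by
  have h := hcontact.isFlatContactFrame hflat hE_smooth hE hE_unit
  refine ⟨ContactThree.existsUnique_isDeformedMetric h.toIsOrthonormalFrame hf, fun gf hgf => ?_⟩
  have hd := hgf.isFrameDeformation h hf hf_xi
  refine ⟨⟨_, hd.isAssociated, fun _ hφ => hd.eq_frameEnd hφ⟩, fun φf hφ => ?_⟩
  obtain rfl := hd.eq_frameEnd hφ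
  have hκ : ContMDiff (𝓡 3) 𝓘(ℝ) ∞ (fun x => f x - f x ^ 2 / 2) :=
    hf.sub (ContactThree.contMDiff_sq_div_two hf)
  have hκ' : ContMDiff (𝓡 3) 𝓘(ℝ) ∞ (fun x => 2 - f x + f x ^ 2 / 2) :=
    (contMDiff_const.sub hf).add (ContactThree.contMDiff_sq_div_two hf)
  -- The Levi-Civita connection of the flat metric serves as the torsion free starting point for
  -- that of `gf`.
  obtain ⟨D, hD, -⟩ := hflat
  obtain ⟨nabla, hLC⟩ := ContactThree.exists_isLeviCivita gf D hD.1
  refine ⟨hd.isContactMetric hcontact.contact, hκ.mul hκ', contMDiff_const.mul hκ,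
    nabla, hLC, fun X hX x => ?_⟩
  rw [hd.curvature_xi hLC hX]
  -- Here `1 - d = f - f²/2` and `1 + d = 2 - f + f²/2`.
  congr 2 <;> ring
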